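/- Let $A$ be a cosimplicial abelian group, and let $H^p(A)$ denote the $p$-th cohomology group of the cochain complex $A^0\to A^1\to A^2\to\cdots$ with coboundary $\delta=\sum_i(-1)^i d^i$. For $n\ge 0$ let $K(A,n)$ be the cosimplicial object in simplicial abelian groups which in cosimplicial degree $c$ is the simplicial abelian group corresponding, under the Dold–Kan correspondence, to the chain complex with $A^c$ in degree $n$ and $0$ in all other degrees. Let $\Delta$ be the cosimplicial space $\mathbf{m}\mapsto\Delta^m$, and for cosimplicial spaces $X,Y$ let $\mathbf{hom}(X,Y)$ be the simplicial set whose $m$-simplices are the cosimplicial space maps $X\times\Delta^m\to Y$. Then $\mathbf{hom}(\Delta,K(A,n))$ is a simplicial abelian group, and its homotopy groups, based at $0$, are given for all $k,n\ge 0$ by group isomorphisms, natural in $A$, $$\pi_k\,\mathbf{hom}(\Delta,K(A,n))\;\cong\;\begin{cases}H^{n-k}(A)&\text{if }0\le k\le n,\\ 0&\text{if }k>n.\end{cases}$$ -/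

import Mathlib

open CategoryTheory MonoidalCategory Simplicial Opposite

universe u

namespace AbelianCosimplicial

/-! ### Underlying spaces and pointwise addition of maps -/

/-- The underlying simplicial set of a simplicial abelian group. -/
abbrev toSSet (G : SimplicialObject AddCommGrpCat.{u}) : SSet.{u} :=
  G ⋙ forget AddCommGrpCat.{u}

/-- The underlying cosimplicial space of a cosimplicial simplicial abelian group. -/
abbrev toCosimplicialSpace (B : CosimplicialObject (SimplicialObject AddCommGrpCat.{u})) :
    CosimplicialObject SSet.{u} :=
  B ⋙ (Functor.whiskeringRight _ _ _).obj (forget AddCommGrpCat.{u})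

section MapsToGroup

variable {K L : SSet.{u}} {G : SimplicialObject AddCommGrpCat.{u}}

instance : Zero (K ⟶ toSSet G) where
  zero :=
    { app := fun m => TypeCat.ofHom fun _ => (0 : G.obj m)
      naturality := fun m m' θ => by
        ext x
        exact (map_zero (G.map θ).hom).symm }

instance : Add (K ⟶ toSSet G) where
  add f g :=
    { app := fun m => TypeCat.ofHom fun x => ((f.app m x : G.obj m) + (g.app m x : G.obj m) : G.obj m)
      naturality := fun m m' θ => by
        ext x
        have hf := ConcreteCategory.congr_hom (f.naturality θ) x
        have hg := ConcreteCategory.congr_hom (g.naturality θ) x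
        have := map_add (G.map θ).hom (f.app m x : G.obj m) (g.app m x : G.obj m)
        exact (congrArg₂ (fun a b : G.obj m' => a + b) hf hg).trans this.symm }

instance : Neg (K ⟶ toSSet G) where
  neg f :=
    { app := fun m => TypeCat.ofHom fun x => (-(f.app m x : G.obj m) : G.obj m)
      naturality := fun m m' θ => by
        ext x
        have hf := ConcreteCategory.congr_hom (f.naturality θ) x
        exact (congrArg (fun a : G.obj m' => -a) hf).trans
          (map_neg (G.map θ).hom (f.app m x : G.obj m)).symm }

lemma map_ext {f g : K ⟶ toSSet G} (h : ∀ m (x : K.obj m), f.app m x = g.app m x) : f = g := by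
  ext m x
  exact h m x

lemma add_app (f g : K ⟶ toSSet G) (m) (x : K.obj m) :
    ((f + g).app m x : G.obj m) = (f.app m x : G.obj m) + (g.app m x : G.obj m) := rfl

lemma zero_app (m) (x : K.obj m) : ((0 : K ⟶ toSSet G).app m x : G.obj m) = 0 := rfl

lemma neg_app (f : K ⟶ toSSet G) (m) (x : K.obj m) :
    ((-f).app m x : G.obj m) = -(f.app m x : G.obj m) := rfl

instance : AddCommGroup (K ⟶ toSSet G) where
  add_assoc f g h := map_ext fun m x => add_assoc (G := G.obj m) _ _ _
  zero_add f := map_ext fun m x => zero_add (M := G.obj m) _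
  add_zero f := map_ext fun m x => add_zero (M := G.obj m) _
  add_comm f g := map_ext fun m x => add_comm (G := G.obj m) _ _
  neg_add_cancel f := map_ext fun m x => neg_add_cancel (G := G.obj m) _
  nsmul := nsmulRec
  zsmul := zsmulRec

lemma comp_add (i : L ⟶ K) (f g : K ⟶ toSSet G) : i ≫ (f + g) = i ≫ f + i ≫ g := rfl

lemma comp_neg (i : L ⟶ K) (f : K ⟶ toSSet G) : i ≫ (-f) = -(i ≫ f) := rfl

lemma comp_zero (i : L ⟶ K) : i ≫ (0 : K ⟶ toSSet G) = 0 := rfl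

end MapsToGroup

/-! ### Simplicial homotopy groups -/

/-- The `k`-th homotopy set `π_k(X, x)` of a (Kan) simplicial set `X` at a vertex `x`:
`k`-simplices `Δ[k] ⟶ X` which are constant at `x` on the boundary `∂Δ[k]`, modulo the
relation `f ∼ g` that there is a `(k+1)`-simplex with `d_k = f`, `d_{k+1} = g` and all other
faces constant at `x`. -/
def HomotopySet (X : SSet.{u}) (k : ℕ) (x : X _⦋0⦌) : Type u :=
  Quot fun f g : X.PtSimplex k x => Nonempty (SSet.PtSimplex.RelStruct f g (Fin.last k))

section HomotopyGroup

variable {G H : SimplicialObject AddCommGrpCat.{u}} {k : ℕ}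

/-- The vertex `0` of a simplicial abelian group. -/
def basePt (G : SimplicialObject AddCommGrpCat.{u}) : (toSSet G) _⦋0⦌ :=
  (0 : G.obj (op ⦋0⦌))

lemma const_basePt {K : SSet.{u}} : (SSet.const (basePt G) : K ⟶ toSSet G) = 0 :=
  map_ext fun _ _ => map_zero (G.map _).hom

/-- `k`-simplices of a simplicial abelian group which vanish on the boundary. -/
abbrev Cycle (G : SimplicialObject AddCommGrpCat.{u}) (k : ℕ) : Type u :=
  (toSSet G).PtSimplex k (basePt G)

lemma Cycle.comm_zero (f : Cycle G k) : (SSet.boundary k).ι ≫ f.map = 0 := by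
  rw [f.comm, SSet.Subcomplex.ofSimplex_ι, SSet.comp_const, const_basePt]

/-- A map `Δ[k] ⟶ G` which is zero on the boundary, as a pointed simplex. -/
def Cycle.mk (f : Δ[k] ⟶ toSSet G) (hf : (SSet.boundary k).ι ≫ f = 0) : Cycle G k where
  map := f
  comm := by rw [hf, SSet.Subcomplex.ofSimplex_ι, SSet.comp_const, const_basePt]

instance : Zero (Cycle G k) := ⟨Cycle.mk 0 rfl⟩

instance : Add (Cycle G k) :=
  ⟨fun f g => Cycle.mk (f.map + g.map) (by
    rw [comp_add, f.comm_zero, g.comm_zero, add_zero])⟩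

instance : Neg (Cycle G k) :=
  ⟨fun f => Cycle.mk (-f.map) (by rw [comp_neg, f.comm_zero, neg_zero])⟩

lemma Cycle.add_map (f g : Cycle G k) : (f + g).map = f.map + g.map := rfl
lemma Cycle.neg_map (f : Cycle G k) : (-f).map = -f.map := rfl
lemma Cycle.zero_map : (0 : Cycle G k).map = 0 := rfl

instance : AddCommGroup (Cycle G k) where
  add_assoc f g h := SSet.RelativeMorphism.ext (add_assoc f.map g.map h.map)
  zero_add f := SSet.RelativeMorphism.ext (zero_add f.map)
  add_zero f := SSet.RelativeMorphism.ext (add_zero f.map)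
  add_comm f g := SSet.RelativeMorphism.ext (add_comm f.map g.map)
  neg_add_cancel f := SSet.RelativeMorphism.ext (neg_add_cancel f.map)
  nsmul := nsmulRec
  zsmul := zsmulRec

open SSet.PtSimplex

/-- Homotopies add. -/
def relAdd {f f' g g' : Cycle G k} {i : Fin (k + 1)} (r : RelStruct f f' i)
    (s : RelStruct g g' i) : RelStruct (f + g) (f' + g') i where
  map := r.map + s.map
  δ_castSucc_map := by
    rw [comp_add, r.δ_castSucc_map, s.δ_castSucc_map, Cycle.add_map]
  δ_succ_map := by rw [comp_add, r.δ_succ_map, s.δ_succ_map, Cycle.add_map]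
  δ_map_of_lt j hj := by
    rw [comp_add, r.δ_map_of_lt j hj, s.δ_map_of_lt j hj, const_basePt, add_zero]
  δ_map_of_gt j hj := by
    rw [comp_add, r.δ_map_of_gt j hj, s.δ_map_of_gt j hj, const_basePt, add_zero]

/-- Homotopies can be negated. -/
def relNeg {f f' : Cycle G k} {i : Fin (k + 1)} (r : RelStruct f f' i) :
    RelStruct (-f) (-f') i where
  map := -r.map
  δ_castSucc_map := by rw [comp_neg, r.δ_castSucc_map, Cycle.neg_map]
  δ_succ_map := by rw [comp_neg, r.δ_succ_map, Cycle.neg_map]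
  δ_map_of_lt j hj := by rw [comp_neg, r.δ_map_of_lt j hj, const_basePt, neg_zero]
  δ_map_of_gt j hj := by rw [comp_neg, r.δ_map_of_gt j hj, const_basePt, neg_zero]

instance : Add (HomotopySet (toSSet G) k (basePt G)) :=
  ⟨Quot.map₂ (fun f g : Cycle G k => f + g)
    (fun f _ _ ⟨r⟩ => ⟨relAdd (.refl f _) r⟩) (fun _ _ g ⟨r⟩ => ⟨relAdd r (.refl g _)⟩)⟩

instance : Zero (HomotopySet (toSSet G) k (basePt G)) := ⟨Quot.mk _ (0 : Cycle G k)⟩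

instance : Neg (HomotopySet (toSSet G) k (basePt G)) :=
  ⟨Quot.map (fun f : Cycle G k => -f) (fun _ _ ⟨r⟩ => ⟨relNeg r⟩)⟩

/-- `π_k(G, 0)` is an abelian group by adding representatives in the simplicial abelian
group `G`. -/
instance : AddCommGroup (HomotopySet (toSSet G) k (basePt G)) where
  add_assoc := by
    rintro ⟨f⟩ ⟨g⟩ ⟨h⟩
    exact congrArg (Quot.mk _) (add_assoc (G := Cycle G k) f g h)
  zero_add := by
    rintro ⟨f⟩
    exact congrArg (Quot.mk _) (zero_add (M := Cycle G k) f)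
  add_zero := by
    rintro ⟨f⟩
    exact congrArg (Quot.mk _) (add_zero (M := Cycle G k) f)
  add_comm := by
    rintro ⟨f⟩ ⟨g⟩
    exact congrArg (Quot.mk _) (add_comm (G := Cycle G k) f g)
  neg_add_cancel := by
    rintro ⟨f⟩
    exact congrArg (Quot.mk _) (neg_add_cancel (G := Cycle G k) f)
  nsmul := nsmulRec
  zsmul := zsmulRec

/-- The class of a pointed simplex in `π_k(G, 0)`. -/
def homotopyClass (f : Cycle G k) : HomotopySet (toSSet G) k (basePt G) := Quot.mk _ f

lemma homotopyClass_eq_iff (f g : Cycle G k) :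
    homotopyClass f = homotopyClass g ↔ Nonempty (RelStruct f g (Fin.last k)) := by
  refine ⟨fun h => ?_, fun h => Quot.sound h⟩
  have h' := Quot.eqvGen_exact h
  clear h
  induction h' with
  | rel _ _ h => exact h
  | refl f => exact ⟨.refl f _⟩
  | symm f g _ ih =>
    obtain ⟨r⟩ := ih
    refine ⟨(relAdd (relNeg r) (.refl (f + g) _)).copy ?_ ?_⟩ <;> abel
  | trans f g l _ _ h1 h2 =>
    obtain ⟨r⟩ := h1
    obtain ⟨s⟩ := h2
    refine ⟨(relAdd (relAdd r s) (.refl (-g) _)).copy ?_ ?_⟩ <;> abel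

lemma const_eq_zero : (SSet.RelativeMorphism.const : Cycle G k) = 0 :=
  SSet.RelativeMorphism.ext const_basePt

/-- Multiplication data add. -/
def mulAdd {f g h f' g' h' : Cycle G k} {i : Fin k} (r : MulStruct f g h i)
    (s : MulStruct f' g' h' i) : MulStruct (f + f') (g + g') (h + h') i where
  map := r.map + s.map
  δ_castSucc_castSucc_map := by
    rw [comp_add, r.δ_castSucc_castSucc_map, s.δ_castSucc_castSucc_map, Cycle.add_map]
  δ_succ_castSucc_map := by
    rw [comp_add, r.δ_succ_castSucc_map, s.δ_succ_castSucc_map, Cycle.add_map]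
  δ_succ_succ_map := by rw [comp_add, r.δ_succ_succ_map, s.δ_succ_succ_map, Cycle.add_map]
  δ_map_of_lt j hj := by
    rw [comp_add, r.δ_map_of_lt j hj, s.δ_map_of_lt j hj, const_basePt, add_zero]
  δ_map_of_gt j hj := by
    rw [comp_add, r.δ_map_of_gt j hj, s.δ_map_of_gt j hj, const_basePt, add_zero]

/-- The addition of `π_{k+1}(G, 0)` is the usual multiplication of simplicial homotopy groups,
given by filling horns. -/
theorem add_eq_iff_mulStruct (f g h : Cycle G (k + 1)) :
    homotopyClass f + homotopyClass g = homotopyClass h ↔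
      Nonempty (MulStruct f g h (Fin.last k)) := by
  have key : ∀ a b : Cycle G (k + 1), Nonempty (MulStruct a b (a + b) (Fin.last k)) := by
    intro a b
    have m := mulAdd (MulStruct.mulOne a (Fin.last k)) (MulStruct.oneMul b (Fin.last k))
    rw [const_eq_zero, add_zero, zero_add] at m
    exact ⟨m⟩
  have e : homotopyClass f + homotopyClass g = homotopyClass (f + g) := rfl
  rw [e]
  constructor
  · intro H
    obtain ⟨r⟩ := (homotopyClass_eq_iff _ _).1 (H.symm)
    obtain ⟨m⟩ := key f g
    have r' := relAdd r (.refl (-(f + g)) _)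
    rw [add_neg_cancel, ← Fin.succ_last, ← const_eq_zero] at r'
    have m' := mulAdd (relStructSuccEquivMulStruct r') m
    rw [const_eq_zero, zero_add, zero_add, neg_add_cancel_right] at m'
    exact ⟨m'⟩
  · rintro ⟨m⟩
    obtain ⟨m'⟩ := key (-f) (-g)
    have q := mulAdd m m'
    rw [add_neg_cancel, add_neg_cancel, ← const_eq_zero] at q
    have r := relAdd (relStructSuccEquivMulStruct.symm q) (.refl (f + g) _)
    rw [const_eq_zero, zero_add, Fin.succ_last] at r
    refine ((homotopyClass_eq_iff _ _).2 ⟨r.copy ?_ rfl⟩).symm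
    abel

/-- The map of pointed simplices induced by a homomorphism. -/
def Cycle.mapHom (φ : G ⟶ H) (f : Cycle G k) : Cycle H k :=
  Cycle.mk (f.map ≫ Functor.whiskerRight φ (forget AddCommGrpCat)) (by
    rw [← Category.assoc, f.comm_zero]
    exact map_ext fun m _ => map_zero (φ.app m).hom)

lemma Cycle.mapHom_add (φ : G ⟶ H) (f g : Cycle G k) :
    (f + g).mapHom φ = f.mapHom φ + g.mapHom φ :=
  SSet.RelativeMorphism.ext <| map_ext fun m _ => map_add (φ.app m).hom _ _

/-- Homotopies are preserved by homomorphisms. -/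
def relMap (φ : G ⟶ H) {f g : Cycle G k} {i : Fin (k + 1)} (r : RelStruct f g i) :
    RelStruct (f.mapHom φ) (g.mapHom φ) i where
  map := r.map ≫ Functor.whiskerRight φ (forget AddCommGrpCat)
  δ_castSucc_map := by rw [r.δ_castSucc_map_assoc]; rfl
  δ_succ_map := by rw [r.δ_succ_map_assoc]; rfl
  δ_map_of_lt j hj := by
    rw [r.δ_map_of_lt_assoc j hj, const_basePt, const_basePt]
    exact map_ext fun m _ => map_zero (φ.app m).hom
  δ_map_of_gt j hj := by
    rw [r.δ_map_of_gt_assoc j hj, const_basePt, const_basePt]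
    exact map_ext fun m _ => map_zero (φ.app m).hom

/-- The homotopy group functor `G ↦ π_k(G, 0)` on simplicial abelian groups. -/
def homotopyGroupFunctor (k : ℕ) :
    SimplicialObject AddCommGrpCat.{u} ⥤ AddCommGrpCat.{u} where
  obj G := AddCommGrpCat.of (HomotopySet (toSSet G) k (basePt G))
  map φ := AddCommGrpCat.ofHom <| AddMonoidHom.mk'
    (Quot.map (Cycle.mapHom φ) fun _ _ ⟨r⟩ => ⟨relMap φ r⟩) (by
      rintro ⟨f⟩ ⟨g⟩
      exact congrArg (Quot.mk _) (Cycle.mapHom_add φ f g))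
  map_id G := by
    ext ⟨f⟩
    rfl
  map_comp φ ψ := by
    ext ⟨f⟩
    rfl

end HomotopyGroup

/-! ### Function complexes of cosimplicial spaces -/

/-- The functor `m ↦ X × Δ[m]`; the cosimplicial space `X × Δ[m]` is `X^c × Δ[m]` in
cosimplicial degree `c`. -/
abbrev prodSimplex (X : CosimplicialObject SSet.{u}) :
    SimplexCategory ⥤ CosimplicialObject SSet.{u} :=
  SSet.stdSimplex ⋙ tensoringRight SSet.{u} ⋙
    (Functor.whiskeringLeft SimplexCategory SSet.{u} SSet.{u}).obj X

/-- The function complex `hom(X, Y)` of cosimplicial spaces: its `m`-simplices are the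
cosimplicial space maps `X × Δ[m] ⟶ Y`. -/
def homComplex (X Y : CosimplicialObject SSet.{u}) : SSet.{u} where
  obj m := (prodSimplex X).obj m.unop ⟶ Y
  map θ := TypeCat.ofHom fun f => (prodSimplex X).map θ.unop ≫ f
  map_id m := ((prodSimplex X).op ⋙ yoneda.obj Y).map_id m
  map_comp θ θ' := ((prodSimplex X).op ⋙ yoneda.obj Y).map_comp θ θ'

section CosimplicialMapsToGroup

variable {X Y : CosimplicialObject SSet.{u}}
  {B C : CosimplicialObject (SimplicialObject AddCommGrpCat.{u})}

/-- The component in cosimplicial degree `c`, as a map into a simplicial abelian group. -/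
def component (f : X ⟶ toCosimplicialSpace B) (c : SimplexCategory) :
    X.obj c ⟶ toSSet (B.obj c) := f.app c

lemma cosimplicialMap_ext {f g : X ⟶ toCosimplicialSpace B}
    (h : ∀ c, component f c = component g c) : f = g :=
  NatTrans.ext (funext h)

lemma component_naturality (f : X ⟶ toCosimplicialSpace B) {c c' : SimplexCategory}
    (θ : c ⟶ c') :
    X.map θ ≫ component f c' =
      component f c ≫ Functor.whiskerRight (B.map θ) (forget AddCommGrpCat) :=
  f.naturality θ

instance : Zero (X ⟶ toCosimplicialSpace B) where
  zero :=
    { app := fun c => (0 : X.obj c ⟶ toSSet (B.obj c))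
      naturality := fun _ c' θ =>
        (map_ext fun m _ => (map_zero ((B.map θ).app m).hom).symm :
          (0 : X.obj _ ⟶ toSSet (B.obj c')) = _) }

instance : Add (X ⟶ toCosimplicialSpace B) where
  add f g :=
    { app := fun c => component f c + component g c
      naturality := fun c c' θ => by
        change X.map θ ≫ (component f c' + component g c') =
          (component f c + component g c) ≫ Functor.whiskerRight (B.map θ) (forget AddCommGrpCat)
        rw [comp_add, component_naturality, component_naturality]
        exact map_ext fun m x => (map_add ((B.map θ).app m).hom _ _).symm }

instance : Neg (X ⟶ toCosimplicialSpace B) where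
  neg f :=
    { app := fun c => -component f c
      naturality := fun c c' θ => by
        change X.map θ ≫ (-component f c') =
          (-component f c) ≫ Functor.whiskerRight (B.map θ) (forget AddCommGrpCat)
        rw [comp_neg, component_naturality]
        exact map_ext fun m x => (map_neg ((B.map θ).app m).hom _).symm }

/-- Cosimplicial space maps into a cosimplicial simplicial abelian group are added pointwise. -/
instance : AddCommGroup (X ⟶ toCosimplicialSpace B) where
  add_assoc f g h := cosimplicialMap_ext fun _ => add_assoc (component f _) _ _
  zero_add f := cosimplicialMap_ext fun _ => zero_add (component f _)
  add_zero f := cosimplicialMap_ext fun _ => add_zero (component f _)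
  add_comm f g := cosimplicialMap_ext fun _ => add_comm (component f _) _
  neg_add_cancel f := cosimplicialMap_ext fun _ => neg_add_cancel (component f _)
  nsmul := nsmulRec
  zsmul := zsmulRec

lemma precomp_add (i : Y ⟶ X) (f g : X ⟶ toCosimplicialSpace B) :
    i ≫ (f + g) = i ≫ f + i ≫ g := rfl

lemma add_postcomp (f g : X ⟶ toCosimplicialSpace B) (β : B ⟶ C) :
    (f + g) ≫ Functor.whiskerRight β ((Functor.whiskeringRight _ _ _).obj (forget _)) =
      f ≫ Functor.whiskerRight β ((Functor.whiskeringRight _ _ _).obj (forget _)) +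
      g ≫ Functor.whiskerRight β ((Functor.whiskeringRight _ _ _).obj (forget _)) :=
  cosimplicialMap_ext fun c => map_ext fun m _ => map_add ((β.app c).app m).hom _ _

end CosimplicialMapsToGroup

/-- The function complex `hom(X, B)` into a cosimplicial simplicial abelian group, with its
structure of simplicial abelian group. -/
def homComplexGroup (X : CosimplicialObject SSet.{u})
    (B : CosimplicialObject (SimplicialObject AddCommGrpCat.{u})) :
    SimplicialObject AddCommGrpCat.{u} where
  obj m := AddCommGrpCat.of ((prodSimplex X).obj m.unop ⟶ toCosimplicialSpace B)
  map θ := AddCommGrpCat.ofHom <| AddMonoidHom.mk' (fun f => (prodSimplex X).map θ.unop ≫ f)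
    fun f g => precomp_add _ f g
  map_id m := by
    refine AddCommGrpCat.hom_ext (AddMonoidHom.ext fun f => ?_)
    exact ConcreteCategory.congr_hom ((homComplex X (toCosimplicialSpace B)).map_id m) f
  map_comp θ θ' := by
    refine AddCommGrpCat.hom_ext (AddMonoidHom.ext fun f => ?_)
    exact ConcreteCategory.congr_hom ((homComplex X (toCosimplicialSpace B)).map_comp θ θ') f

/-- Forgetting the addition gives back the function complex of cosimplicial spaces. -/
lemma toSSet_homComplexGroup (X : CosimplicialObject SSet.{u})
    (B : CosimplicialObject (SimplicialObject AddCommGrpCat.{u})) :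
    toSSet (homComplexGroup X B) = homComplex X (toCosimplicialSpace B) := rfl

/-- `hom(X, B)` as a functor of `B`. -/
def homComplexGroupFunctor (X : CosimplicialObject SSet.{u}) :
    CosimplicialObject (SimplicialObject AddCommGrpCat.{u}) ⥤
      SimplicialObject AddCommGrpCat.{u} where
  obj B := homComplexGroup X B
  map β :=
    { app := fun m => AddCommGrpCat.ofHom <| AddMonoidHom.mk'
        (fun (f : (prodSimplex X).obj m.unop ⟶ _) =>
          f ≫ Functor.whiskerRight β ((Functor.whiskeringRight _ _ _).obj (forget _)))
        fun f g => add_postcomp f g β }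

/-! ### Eilenberg-Mac Lane objects and cohomology -/

/-- The functor `A ↦ K(A, n)`: in each cosimplicial degree, the simplicial abelian group which
corresponds under Dold-Kan to the chain complex with `A^c` in degree `n` and `0` elsewhere. -/
noncomputable def eilenbergMacLane (n : ℕ) :
    CosimplicialObject AddCommGrpCat.{u} ⥤
      CosimplicialObject (SimplicialObject AddCommGrpCat.{u}) :=
  (Functor.whiskeringRight _ _ _).obj
    (HomologicalComplex.single AddCommGrpCat.{u} (ComplexShape.down ℕ) n ⋙ Abelian.DoldKan.Γ)

/-- The functor `A ↦ π_k hom(Δ, K(A, n))`, where `Δ` is the cosimplicial space `c ↦ Δ[c]` and the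
base point is `0`. -/
noncomputable def piHom (k n : ℕ) :
    CosimplicialObject AddCommGrpCat.{u} ⥤ AddCommGrpCat.{u} :=
  eilenbergMacLane n ⋙ homComplexGroupFunctor SSet.stdSimplex.{u} ⋙ homotopyGroupFunctor k

/-- The group `piHom k n` at `A` is the simplicial homotopy group of the function complex
`hom(Δ, K(A, n))` of cosimplicial spaces, based at the zero map. -/
lemma piHom_obj (k n : ℕ) (A : CosimplicialObject AddCommGrpCat.{u}) :
    ((piHom k n).obj A : Type u) =
      HomotopySet (homComplex SSet.stdSimplex.{u} (toCosimplicialSpace ((eilenbergMacLane n).obj A)))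
        k (0 : (prodSimplex SSet.stdSimplex.{u}).obj ⦋0⦌ ⟶
          toCosimplicialSpace ((eilenbergMacLane n).obj A)) := rfl

/-- The functor `A ↦ H^p(A)`: the `p`-th cohomology of the cochain complex
`A^0 ⟶ A^1 ⟶ A^2 ⟶ ⋯` with coboundary `∑ (-1)^i d^i`. -/
noncomputable def cohomology (p : ℕ) :
    CosimplicialObject AddCommGrpCat.{u} ⥤ AddCommGrpCat.{u} :=
  AlgebraicTopology.alternatingCofaceMapComplex AddCommGrpCat.{u} ⋙
    HomologicalComplex.homologyFunctor AddCommGrpCat.{u} (ComplexShape.up ℕ) p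

end AbelianCosimplicial

/-!
The function complex `hom(Δ, K(A, n))` is computed from an explicit model of `K(A, n)`. For an
abelian group `M`, the simplicial group which in degree `m` consists of the normalized `n`-cocycles
on `⦋m⦌` with values in `M` has normalized Moore complex `M` in degree `n`
(`HigherFacesZero.eq_zero_of_ne`, `isIso_mooreEval`), so the Dold-Kan equivalence identifies it
with `K(M, n)` (`cocycleModelIso`). Maps of cosimplicial spaces `Δ × Δ[m] ⟶ K(A, n)` are then
families of cocycles on `Δ[c] × Δ[m]` with values in `A^c`, natural in `c`. By the Yoneda lemma such
a family is the same as a function `a` from the `n`-simplices of `⦋m⦌` to `A^n` with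
`s^i a(s_i β) = 0` and `∑ (-1)^i d^i a(d_i β) = 0` (`modelMapEquiv`): a normalized `n`-cocycle of
the cosimplicial group `A^{Δ[m]}`, which has the functions `Δ[m]_c → A^c` in degree `c`.

For a simplicial subset `L` of `Δ[m]`, let `A^{(Δ[m], L)}` be the cosimplicial subgroup of the
cochains vanishing on `L` (`relCochainsObj`, where `L` is encoded as a sieve). A representative of
an element of `π_k` is a normalized `n`-cocycle of `A^{(Δ[k], ∂Δ[k])}`, and it represents zero
if and only if it is the restriction to the last face of a normalized cocycle relative to the horn
of `Δ[k + 1]` at its last vertex. As the cochains relative to the horn are acyclic, because the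
contraction of the simplex onto its last vertex preserves the horn (`hornHomotopy`), and as
normalized cochains compute the same cohomology as all cochains (`normalize_mem`,
`exists_d_eq_sub_normalize`), it follows that
`π_k = H^n(A^{(Δ[k], ∂Δ[k])})` (`homotopyIso`). The long exact sequence of
`0 → A^{(Δ[k+1], ∂)} → A^{(Δ[k+1], horn)} → A^{(Δ[k], ∂)} → 0` shifts the dimension
(`boundaryShift`), so this group is `H^{n-k}(A)` for `k ≤ n` (`boundaryCohomology`). For `k > n`
all `n`-simplices of `Δ[k]` lie in the boundary, and there is no nonzero representative.
-/

namespace AbelianCosimplicial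
open AlgebraicTopology

/-! ### Cochain complexes of abelian groups in terms of elements -/

section CohomologyClass

variable (K : CochainComplex AddCommGrpCat.{u} ℕ) (n : ℕ)

/-- The group of cocycles, mapped to the cycles object. -/
noncomputable def liftCocycles : AddCommGrpCat.of (K.d n (n + 1)).hom.ker ⟶ K.cycles n :=
  K.liftCycles (AddCommGrpCat.ofHom (K.d n (n + 1)).hom.ker.subtype) (n + 1) (by simp) (by
    ext x
    exact x.2)

lemma iCycles_liftCocycles (x : (K.d n (n + 1)).hom.ker) :
    K.iCycles n (liftCocycles K n x) = x :=
  ConcreteCategory.congr_hom (K.liftCycles_i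
    (AddCommGrpCat.ofHom (K.d n (n + 1)).hom.ker.subtype) (n + 1) _ _) x

/-- The class of a cocycle, as a homomorphism from the group of cocycles to cohomology. -/
noncomputable def cohomologyClass : (K.d n (n + 1)).hom.ker →+ K.homology n :=
  (liftCocycles K n ≫ K.homologyπ n).hom

lemma cohomologyClass_eq (x : (K.d n (n + 1)).hom.ker) (z : K.cycles n)
    (h : K.iCycles n z = x) : cohomologyClass K n x = K.homologyπ n z := by
  have : liftCocycles K n x = z := by
    apply (AddCommGrpCat.mono_iff_injective (K.iCycles n)).1 inferInstance
    rw [h, iCycles_liftCocycles]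
  rw [← this]
  rfl

lemma cohomologyClass_surjective : Function.Surjective (cohomologyClass K n) := by
  intro y
  obtain ⟨z, rfl⟩ := (AddCommGrpCat.epi_iff_surjective (K.homologyπ n)).1 inferInstance y
  refine ⟨⟨K.iCycles n z, ?_⟩, cohomologyClass_eq K n _ z rfl⟩
  change (K.iCycles n ≫ K.d n (n + 1)) z = 0
  rw [K.iCycles_d]
  rfl

/-- A cocycle has zero class if and only if it is a coboundary. The source degree `i` is left
arbitrary to cover `n = 0`: differentials between nonconsecutive degrees vanish. -/
lemma cohomologyClass_eq_zero_iff (x : (K.d n (n + 1)).hom.ker) :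
    cohomologyClass K n x = 0 ↔ ∃ (i : ℕ) (y : K.X i), K.d i n y = x := by
  constructor
  · intro h
    have hS : (ShortComplex.mk _ _ (K.toCycles_comp_homologyπ _ n)).Exact :=
      ShortComplex.exact_of_g_is_cokernel _ (K.homologyIsCokernel _ n rfl)
    obtain ⟨y, hy⟩ := (ShortComplex.ab_exact_iff _).1 hS (liftCocycles K n x) h
    refine ⟨_, y, ?_⟩
    rw [← iCycles_liftCocycles, ← hy]
    exact (ConcreteCategory.congr_hom (K.toCycles_i _ n) y).symm
  · rintro ⟨i, y, hy⟩
    have := cohomologyClass_eq K n x (K.toCycles i n y) (by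
      rw [← ConcreteCategory.comp_apply, K.toCycles_i, hy])
    rw [this, ← ConcreteCategory.comp_apply, K.toCycles_comp_homologyπ]
    rfl

variable {K} in
lemma homologyMap_cohomologyClass {L : CochainComplex AddCommGrpCat.{u} ℕ} (f : K ⟶ L)
    (x : (K.d n (n + 1)).hom.ker) (hx : f.f n x ∈ (L.d n (n + 1)).hom.ker) :
    HomologicalComplex.homologyMap f n (cohomologyClass K n x) =
      cohomologyClass L n ⟨f.f n x, hx⟩ := by
  obtain ⟨z, hz⟩ : ∃ z, K.iCycles n z = x := ⟨_, iCycles_liftCocycles K n x⟩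
  rw [cohomologyClass_eq K n x z hz,
    cohomologyClass_eq L n _ (HomologicalComplex.cyclesMap f n z),
    ← ConcreteCategory.comp_apply, ← ConcreteCategory.comp_apply,
    HomologicalComplex.homologyπ_naturality]
  rw [← ConcreteCategory.comp_apply, HomologicalComplex.cyclesMap_i, ConcreteCategory.comp_apply,
    hz]

end CohomologyClass

/-! ### Normalized cochains of a cosimplicial abelian group -/

section Normalized

variable (B : CosimplicialObject AddCommGrpCat.{u})

/-- A cosimplicial abelian group `B`, seen as a simplicial object in the opposite of the category
of abelian groups. -/
abbrev opSimplicial : SimplicialObject AddCommGrpCat.{u}ᵒᵖ :=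
  (cosimplicialSimplicialEquiv _).functor.obj (op B)

/-- The cochain complex `B^0 ⟶ B^1 ⟶ ⋯`. -/
abbrev cochains : CochainComplex AddCommGrpCat.{u} ℕ :=
  (alternatingCofaceMapComplex AddCommGrpCat.{u}).obj B

lemma cochains_d_eq_objD (n : ℕ) :
    (cochains B).d n (n + 1) = AlternatingCofaceMapComplex.objD B n := by
  change CochainComplex.of.d (fun n => B.obj ⦋n⦌) (AlternatingCofaceMapComplex.objD B) n (n + 1) = _
  exact CochainComplex.of_d (fun n => B.obj ⦋n⦌) (AlternatingCofaceMapComplex.objD B) n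

/-- The differential comes from the alternating face map complex in the opposite category. This
makes results on simplicial objects in preadditive categories available. -/
lemma cochains_d (n : ℕ) :
    (cochains B).d n (n + 1) =
      ((AlternatingFaceMapComplex.obj (opSimplicial B)).d (n + 1) n).unop := by
  rw [AlternatingFaceMapComplex.obj_d_eq]
  exact (cochains_d_eq_objD B n).trans (AlternatingCofaceMapComplex.d_eq_unop_d B n)

lemma cochains_d_apply (n : ℕ) (b : B.obj ⦋n⦌) :
    (cochains B).d n (n + 1) b = ∑ i : Fin (n + 2), (-1 : ℤ) ^ (i : ℕ) • B.δ i b := by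
  rw [cochains_d_eq_objD, AlternatingCofaceMapComplex.objD]
  have h : ∀ (s : Finset (Fin (n + 2))) (f : Fin (n + 2) → (B.obj ⦋n⦌ ⟶ B.obj ⦋n + 1⦌)),
      (∑ i ∈ s, f i) b = ∑ i ∈ s, f i b := by
    intro s f
    classical
    induction s using Finset.induction_on with
    | empty => rfl
    | insert i s hi ih => rw [Finset.sum_insert hi, Finset.sum_insert hi, ← ih]; rfl
  exact h _ _

/-- The subgroup of normalized `n`-cochains: those which are killed by all the maps which lower
the cosimplicial degree, equivalently by all codegeneracies. -/
def normalized (n : ℕ) : AddSubgroup (B.obj ⦋n⦌) where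
  carrier := {b | ∀ p < n, ∀ σ : ⦋n⦌ ⟶ ⦋p⦌, B.map σ b = 0}
  zero_mem' p _ σ := map_zero (B.map σ).hom
  add_mem' ha hb p hp σ := by rw [map_add, ha p hp σ, hb p hp σ, add_zero]
  neg_mem' ha p hp σ := by rw [map_neg, ha p hp σ, neg_zero]

/-- The projector of the cochain complex of `B` onto the normalized cochains. -/
noncomputable def normalize (n : ℕ) : B.obj ⦋n⦌ ⟶ B.obj ⦋n⦌ :=
  ((DoldKan.PInfty (X := opSimplicial B)).f n).unop

lemma normalize_mem (n : ℕ) (b : B.obj ⦋n⦌) : normalize B n b ∈ normalized B n := by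
  intro p hp σ
  have h : normalize B n ≫ B.map σ = 0 :=
    congrArg Quiver.Hom.unop (DoldKan.degeneracy_comp_PInfty (opSimplicial B) n σ (by
      intro hσ
      have := SimplexCategory.len_le_of_mono σ
      simp at this
      lia))
  exact ConcreteCategory.congr_hom h b

/-- The projector is the identity on normalized cochains, as its complement factors through the
codegeneracies. -/
lemma normalize_eq_self (n : ℕ) {b : B.obj ⦋n⦌} (hb : b ∈ normalized B n) :
    normalize B n b = b := by
  let ι : (opSimplicial B) _⦋n⦌ ⟶ op (AddCommGrpCat.of (normalized B n)) :=
    (AddCommGrpCat.ofHom (normalized B n).subtype).op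
  have h : (DoldKan.QInfty (X := opSimplicial B)).f n ≫ ι = 0 := by
    refine (DoldKan.degeneraciesVanish_iff_QInfty_f_comp (X := opSimplicial B) ι).1 ?_
    cases n with
    | zero => trivial
    | succ n =>
      intro i
      refine Quiver.Hom.unop_inj ?_
      ext x
      exact x.2 n (by lia) (SimplexCategory.σ i)
  have h' : (DoldKan.PInfty (X := opSimplicial B)).f n ≫ ι = ι := by
    have := DoldKan.PInfty_f_add_QInfty_f (X := opSimplicial B) n =≫ ι
    rw [Preadditive.add_comp, h, add_zero] at this
    exact this.trans (Category.id_comp _)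
  exact ConcreteCategory.congr_hom (congrArg Quiver.Hom.unop h') (⟨b, hb⟩ : normalized B n)

lemma d_normalize (n : ℕ) (b : B.obj ⦋n⦌) :
    (cochains B).d n (n + 1) (normalize B n b) =
      normalize B (n + 1) ((cochains B).d n (n + 1) b) := by
  rw [cochains_d]
  have h := congrArg Quiver.Hom.unop
    ((DoldKan.PInfty (X := opSimplicial B)).comm (n + 1) n)
  exact (ConcreteCategory.congr_hom h b).symm

/-- A cochain homotopy between the projector `normalize` and the identity. -/
noncomputable def normalizeHomotopy (n : ℕ) : (cochains B).X (n + 1) ⟶ (cochains B).X n :=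
  ((DoldKan.homotopyPInftyToId (opSimplicial B)).hom n (n + 1)).unop

lemma normalize_succ (n : ℕ) :
    (normalize B (n + 1) : (cochains B).X (n + 1) ⟶ (cochains B).X (n + 1)) =
      normalizeHomotopy B n ≫ (cochains B).d n (n + 1) +
        (cochains B).d (n + 1) (n + 2) ≫ normalizeHomotopy B (n + 1) + 𝟙 _ := by
  have h := (DoldKan.homotopyPInftyToId (opSimplicial B)).comm (n + 1)
  rw [prevD_eq (j' := n + 2) (w := by simp), dNext_eq (i' := n) (w := by simp)] at h
  rw [cochains_d, cochains_d]
  exact congrArg Quiver.Hom.unop h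

/-- A cocycle is cohomologous to its normalization. -/
lemma exists_d_eq_sub_normalize (n : ℕ) (b : B.obj ⦋n⦌) (hb : (cochains B).d n (n + 1) b = 0) :
    ∃ (i : ℕ) (y : (cochains B).X i), (cochains B).d i n y = normalize B n b - b := by
  cases n with
  | zero =>
    refine ⟨0, 0, ?_⟩
    rw [map_zero]
    exact (sub_self b).symm
  | succ n =>
    refine ⟨n, normalizeHomotopy B n b, ?_⟩
    have h := ConcreteCategory.congr_hom (normalize_succ B n) b
    have h' : (show (cochains B).X (n + 1) from normalize B (n + 1) b) =
      (cochains B).d n (n + 1) (normalizeHomotopy B n b) +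
      normalizeHomotopy B (n + 1) ((cochains B).d (n + 1) (n + 2) b) +
        (show (cochains B).X (n + 1) from b) := h
    rw [hb, map_zero, add_zero] at h'
    exact (sub_eq_of_eq_add h').symm

end Normalized

/-! ### Relative cochains on a simplex -/

section RelCochains

variable {m m' : SimplexCategory}

/-- The cosimplicial abelian group of cochains on the simplex `m`, relative to the simplicial
subset given by a sieve `S` on `m`, with coefficients in the cosimplicial abelian group `A`: in
cosimplicial degree `c` it consists of the functions on the `c`-simplices of `m`, with values
in `A^c`, which vanish on `S`. -/
def relCochainsObj (S : Sieve m) (A : CosimplicialObject AddCommGrpCat.{u}) :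
    CosimplicialObject AddCommGrpCat.{u} where
  obj c := AddCommGrpCat.of
    ({ carrier := {a | ∀ β : c ⟶ m, S β → a β = 0}
       zero_mem' := fun _ _ => rfl
       add_mem' := fun ha hb β hβ => by rw [Pi.add_apply, ha β hβ, hb β hβ, add_zero]
       neg_mem' := fun ha β hβ => by rw [Pi.neg_apply, ha β hβ, neg_zero] } :
      AddSubgroup ((c ⟶ m) → A.obj c))
  map {c c'} θ := AddCommGrpCat.ofHom <| AddMonoidHom.mk'
    (fun a => ⟨fun β => A.map θ (a.1 (θ ≫ β)), fun β hβ =>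
      (congrArg (A.map θ) (a.2 _ (S.downward_closed hβ θ))).trans (map_zero (A.map θ).hom)⟩)
    fun a b => Subtype.ext <| funext fun β => map_add (A.map θ).hom _ _
  map_id c := by
    refine AddCommGrpCat.hom_ext (AddMonoidHom.ext fun a => Subtype.ext (funext fun β => ?_))
    change A.map (𝟙 c) (a.1 (𝟙 c ≫ β)) = a.1 β
    rw [A.map_id, Category.id_comp]
    rfl
  map_comp θ θ' := by
    refine AddCommGrpCat.hom_ext (AddMonoidHom.ext fun a => Subtype.ext (funext fun β => ?_))
    change A.map (θ ≫ θ') (a.1 ((θ ≫ θ') ≫ β)) = A.map θ' (A.map θ (a.1 (θ ≫ θ' ≫ β)))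
    rw [A.map_comp, Category.assoc]
    rfl

lemma relCochainsObj_ext {S : Sieve m} {A : CosimplicialObject AddCommGrpCat.{u}}
    {c : SimplexCategory} {a b : (relCochainsObj S A).obj c} (h : ∀ β, a.1 β = b.1 β) : a = b :=
  Subtype.ext (funext h)

/-- Relative cochains on a simplex, as a functor of the coefficients. -/
def relCochains (S : Sieve m) :
    CosimplicialObject AddCommGrpCat.{u} ⥤ CosimplicialObject AddCommGrpCat.{u} where
  obj A := relCochainsObj S A
  map {A A'} f :=
    { app := fun c => AddCommGrpCat.ofHom <| AddMonoidHom.mk'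
        (fun (a : (relCochainsObj S A).obj c) =>
          (⟨fun β => f.app c (a.1 β), fun β hβ =>
            (congrArg (f.app c) (a.2 β hβ)).trans (map_zero (f.app c).hom)⟩ :
            (relCochainsObj S A').obj c))
        fun a b => relCochainsObj_ext fun β => map_add (f.app c).hom _ _
      naturality := fun c c' θ => by
        refine AddCommGrpCat.hom_ext (AddMonoidHom.ext fun a => Subtype.ext (funext fun β => ?_))
        exact (ConcreteCategory.congr_hom (f.naturality θ) (a.1 (θ ≫ β))) }

/-- Restriction of relative cochains along a map of simplices. -/
def relCochainsRestrict (φ : m' ⟶ m) {S' : Sieve m'} {S : Sieve m}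
    (h : ∀ ⦃c⦄ (β : c ⟶ m'), S' β → S (β ≫ φ)) :
    relCochains.{u} S ⟶ relCochains S' where
  app A :=
    { app := fun c => AddCommGrpCat.ofHom <| AddMonoidHom.mk'
        (fun (a : (relCochainsObj S A).obj c) =>
          (⟨fun β => a.1 (β ≫ φ), fun β hβ => a.2 _ (h β hβ)⟩ : (relCochainsObj S' A).obj c))
        fun a b => rfl
      naturality := fun c c' θ => by
        ext a
        refine relCochainsObj_ext fun β => ?_
        change A.map θ (a.1 ((θ ≫ β) ≫ φ)) = A.map θ (a.1 (θ ≫ β ≫ φ))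
        rw [Category.assoc] }

/-- The boundary of the simplex `⦋k⦌`: the simplices which miss some vertex. -/
def boundarySieve (k : ℕ) : Sieve ⦋k⦌ where
  arrows _ β := ∃ i : Fin (k + 1), ∀ x, β x ≠ i
  downward_closed := fun ⟨i, hi⟩ θ => ⟨i, fun x => hi (θ x)⟩

/-- The horn of `⦋k + 1⦌` at its last vertex: the simplices which miss some vertex other than the
last one. -/
def hornSieve (k : ℕ) : Sieve ⦋k + 1⦌ where
  arrows _ β := ∃ i : Fin (k + 1), ∀ x, β x ≠ i.castSucc
  downward_closed := fun ⟨i, hi⟩ θ => ⟨i, fun x => hi (θ x)⟩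

end RelCochains

/-! ### The horn is acyclic -/

section Horn

variable {k : ℕ}

/-- The map `⦋n + 1⦌ ⟶ ⦋k + 1⦌` which is `β ∘ σ j` on the vertices up to `j` and sends the others
to the last vertex. These are the simplices of the prism which contracts `⦋k + 1⦌` onto
its last vertex. -/
def coneHom {n : ℕ} (j : Fin (n + 1)) (β : ⦋n⦌ ⟶ ⦋k + 1⦌) : ⦋n + 1⦌ ⟶ ⦋k + 1⦌ :=
  SimplexCategory.mkHom
    { toFun := fun x => if x ≤ j.castSucc then β (SimplexCategory.σ j x) else Fin.last (k + 1)
      monotone' := fun x y hxy => by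
        dsimp only
        split_ifs with h₁ h₂ h₂
        · exact β.toOrderHom.monotone ((SimplexCategory.σ j).toOrderHom.monotone hxy)
        · exact Fin.le_last _
        · exact absurd (hxy.trans h₂) h₁
        · exact le_rfl }

lemma coneHom_apply {n : ℕ} (j : Fin (n + 1)) (β : ⦋n⦌ ⟶ ⦋k + 1⦌) (x : Fin (n + 2)) :
    coneHom j β x = if x ≤ j.castSucc then β (SimplexCategory.σ j x) else Fin.last (k + 1) := rfl

lemma hornSieve_coneHom {n : ℕ} (j : Fin (n + 1)) {β : ⦋n⦌ ⟶ ⦋k + 1⦌} (hβ : hornSieve k β) :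
    hornSieve k (coneHom j β) := by
  obtain ⟨i, hi⟩ := hβ
  refine ⟨i, fun x => ?_⟩
  rw [coneHom_apply]
  split_ifs
  · exact hi _
  · exact (Fin.castSucc_lt_last i).ne'

/-- Cone maps are compatible with the precomposition with `θ`, when `θ` maps the part up to `j`
and the part after `j` to the corresponding parts for `j'`. -/
lemma comp_coneHom {n n' : ℕ} (j : Fin (n + 1)) (j' : Fin (n' + 1)) (θ : ⦋n + 1⦌ ⟶ ⦋n' + 1⦌)
    (θ' : ⦋n⦌ ⟶ ⦋n'⦌) (h : θ ≫ SimplexCategory.σ j' = SimplexCategory.σ j ≫ θ')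
    (hj : ∀ x : Fin (n + 2), θ x ≤ j'.castSucc ↔ x ≤ j.castSucc) (β : ⦋n'⦌ ⟶ ⦋k + 1⦌) :
    θ ≫ coneHom j' β = coneHom j (θ' ≫ β) := by
  ext x : 3
  change coneHom j' β (θ x) = coneHom j (θ' ≫ β) x
  have h' : SimplexCategory.σ j' (θ x) = θ' (SimplexCategory.σ j x) :=
    congrArg (fun φ : ⦋n + 1⦌ ⟶ ⦋n'⦌ => φ x) h
  rw [coneHom_apply, coneHom_apply, h']
  simp only [hj]
  rfl

variable (A : CosimplicialObject AddCommGrpCat.{u})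

/-- The operators of the contraction: `a ↦ (β ↦ s^j a(coneHom j β))`. -/
def coneOperator {n : ℕ} (j : Fin (n + 1)) :
    (relCochainsObj (hornSieve k) A).obj ⦋n + 1⦌ ⟶ (relCochainsObj (hornSieve k) A).obj ⦋n⦌ :=
  AddCommGrpCat.ofHom <| AddMonoidHom.mk'
    (fun a => ⟨fun β => A.map (SimplexCategory.σ j) (a.1 (coneHom j β)), fun _ hβ =>
      (congrArg (A.map (SimplexCategory.σ j)) (a.2 _ (hornSieve_coneHom j hβ))).trans
        (map_zero (A.map (SimplexCategory.σ j)).hom)⟩)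
    fun _ _ => Subtype.ext <| funext fun _ => map_add (A.map (SimplexCategory.σ j)).hom _ _

lemma map_coneOperator {n n' : ℕ} (j : Fin (n + 1)) (j' : Fin (n' + 1))
    (θ : ⦋n + 1⦌ ⟶ ⦋n' + 1⦌) (θ' : ⦋n⦌ ⟶ ⦋n'⦌)
    (h : θ ≫ SimplexCategory.σ j' = SimplexCategory.σ j ≫ θ')
    (hj : ∀ x : Fin (n + 2), θ x ≤ j'.castSucc ↔ x ≤ j.castSucc) :
    (relCochainsObj (hornSieve k) A).map θ ≫ coneOperator A j' =
      coneOperator A j ≫ (relCochainsObj (hornSieve k) A).map θ' := by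
  ext a
  refine relCochainsObj_ext fun β => ?_
  change A.map (SimplexCategory.σ j') (A.map θ (a.1 (θ ≫ coneHom j' β))) =
    A.map θ' (A.map (SimplexCategory.σ j) (a.1 (coneHom j (θ' ≫ β))))
  rw [comp_coneHom j j' θ θ' h hj, ← ConcreteCategory.comp_apply, ← A.map_comp, h, A.map_comp]
  rfl

lemma δ_comp_coneOperator_apply {n : ℕ} (i : Fin (n + 2)) (j : Fin (n + 1))
    (h : SimplexCategory.δ i ≫ SimplexCategory.σ j = 𝟙 _)
    (a : (relCochainsObj (hornSieve k) A).obj ⦋n⦌) (β : ⦋n⦌ ⟶ ⦋k + 1⦌) :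
    (coneOperator A j ((relCochainsObj (hornSieve k) A).δ i a)).1 β =
      a.1 (SimplexCategory.δ i ≫ coneHom j β) := by
  change A.map (SimplexCategory.σ j) (A.map (SimplexCategory.δ i) _) = _
  rw [← ConcreteCategory.comp_apply, ← A.map_comp, h, A.map_id]
  rfl

lemma δ_apply {n : ℕ} (i : Fin (n + 2)) (x : Fin (n + 1)) :
    SimplexCategory.δ i x = i.succAbove x := rfl

lemma σ_val {n : ℕ} (i : Fin (n + 1)) (x : Fin (n + 2)) :
    (SimplexCategory.σ i x).val = if i.val < x.val then x.val - 1 else x.val := by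
  change (i.predAbove x).val = _
  rw [Fin.predAbove]
  simp only [Fin.lt_def, Fin.val_castSucc]
  split_ifs <;> rfl

lemma δ_val {n : ℕ} (i : Fin (n + 2)) (x : Fin (n + 1)) :
    (SimplexCategory.δ i x).val = if x.val < i.val then x.val else x.val + 1 := by
  change (i.succAbove x).val = _
  rw [Fin.succAbove]
  simp only [Fin.lt_def, Fin.val_castSucc]
  split_ifs <;> rfl

/-- The contraction of the cochains relative to the horn, as a simplicial homotopy between
the identity and zero in the opposite category. -/
def hornHomotopy : SimplicialObject.Homotopy
    (𝟙 (opSimplicial (relCochainsObj (hornSieve k) A))) 0 where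
  h j := (coneOperator A j).op
  h_zero_comp_δ_zero n := by
    refine Quiver.Hom.unop_inj ?_
    ext a
    refine relCochainsObj_ext fun β => ?_
    refine (δ_comp_coneOperator_apply A 0 0 SimplexCategory.δ_comp_σ_self a β).trans ?_
    -- The simplex is constant at the last vertex, so it misses the vertex `0` and is in the horn.
    refine a.2 _ ⟨0, fun x => ?_⟩
    change coneHom 0 β (SimplexCategory.δ 0 x) ≠ _
    rw [coneHom_apply, if_neg (by simp [δ_apply])]
    exact (Fin.castSucc_lt_last 0).ne'
  h_last_comp_δ_last n := by
    refine Quiver.Hom.unop_inj ?_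
    ext a
    refine relCochainsObj_ext fun β => ?_
    refine (δ_comp_coneOperator_apply A (Fin.last _) (Fin.last _)
      SimplexCategory.δ_comp_σ_succ a β).trans ?_
    refine congrArg a.1 ?_
    ext x : 3
    change coneHom (Fin.last n) β (SimplexCategory.δ (Fin.last _) x) = β x
    rw [coneHom_apply, if_pos (by simp [δ_apply, Fin.le_last])]
    exact congrArg (fun φ : ⦋n⦌ ⟶ ⦋n⦌ => β (φ x)) (SimplexCategory.δ_comp_σ_succ (i := Fin.last n))
  h_succ_comp_δ_castSucc_of_lt i j hij :=
    congrArg Quiver.Hom.op (map_coneOperator A _ _ (SimplexCategory.δ i.castSucc)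
      (SimplexCategory.δ i) (SimplexCategory.δ_comp_σ_of_le hij) (fun x => by
        rw [Fin.le_def, Fin.le_def, δ_val]
        simp only [Fin.val_castSucc, Fin.val_succ, Fin.le_def] at hij ⊢
        split_ifs <;> lia))
  h_succ_comp_δ_castSucc_succ {n} j := by
    refine Quiver.Hom.unop_inj ?_
    ext a
    refine relCochainsObj_ext fun β => ?_
    refine (δ_comp_coneOperator_apply A j.castSucc.succ j.succ
      SimplexCategory.δ_comp_σ_self a β).trans
      (Eq.trans ?_ (δ_comp_coneOperator_apply A j.castSucc.succ j.castSucc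
        SimplexCategory.δ_comp_σ_succ a β).symm)
    refine congrArg a.1 ?_
    ext x : 3
    change coneHom j.succ β (SimplexCategory.δ j.castSucc.succ x) =
      coneHom j.castSucc β (SimplexCategory.δ j.castSucc.succ x)
    rw [coneHom_apply, coneHom_apply]
    have h₁ : SimplexCategory.σ j.succ (SimplexCategory.δ j.castSucc.succ x) = x :=
      congrArg (fun φ : ⦋n + 1⦌ ⟶ ⦋n + 1⦌ => φ x) (SimplexCategory.δ_comp_σ_self (i := j.succ))
    have h₂ : SimplexCategory.σ j.castSucc (SimplexCategory.δ j.castSucc.succ x) = x :=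
      congrArg (fun φ : ⦋n + 1⦌ ⟶ ⦋n + 1⦌ => φ x) (SimplexCategory.δ_comp_σ_succ (i := j.castSucc))
    rw [h₁, h₂]
    refine if_congr ?_ rfl rfl
    rw [Fin.le_def, Fin.le_def, δ_val]
    simp only [Fin.val_castSucc, Fin.val_succ]
    split_ifs <;> lia
  h_castSucc_comp_δ_succ_of_lt i j hij :=
    congrArg Quiver.Hom.op (map_coneOperator A _ _ (SimplexCategory.δ i.succ)
      (SimplexCategory.δ i) (SimplexCategory.δ_comp_σ_of_gt hij) (fun x => by
        rw [Fin.le_def, Fin.le_def, δ_val]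
        simp only [Fin.val_castSucc, Fin.val_succ, Fin.lt_def] at hij ⊢
        split_ifs <;> lia))
  h_comp_σ_castSucc_of_le i j hij :=
    congrArg Quiver.Hom.op (map_coneOperator A _ _ (SimplexCategory.σ i.castSucc)
      (SimplexCategory.σ i) (SimplexCategory.σ_comp_σ hij) (fun x => by
        rw [Fin.le_def, Fin.le_def, σ_val]
        simp only [Fin.val_castSucc, Fin.val_succ, Fin.le_def] at hij ⊢
        split_ifs <;> lia))
  h_comp_σ_succ_of_lt i j hij :=
    congrArg Quiver.Hom.op (map_coneOperator A _ _ (SimplexCategory.σ i.succ)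
      (SimplexCategory.σ i) (SimplexCategory.σ_comp_σ hij).symm (fun x => by
        rw [Fin.le_def, Fin.le_def, σ_val]
        simp only [Fin.val_castSucc, Fin.val_succ, Fin.le_def] at hij ⊢
        split_ifs <;> lia))

/-- The cochain complex of a contractible cosimplicial abelian group is exact. -/
lemma exists_d_eq_of_homotopy {B : CosimplicialObject AddCommGrpCat.{u}}
    (h₀ : SimplicialObject.Homotopy (𝟙 (opSimplicial B)) 0) (n : ℕ) (a : (cochains B).X n)
    (ha : (cochains B).d n (n + 1) a = 0) :
    ∃ (i : ℕ) (y : (cochains B).X i), (cochains B).d i n y = a := by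
  have h := h₀.toChainHomotopy.comm n
  rw [prevD_eq (j' := n + 1) (w := by simp)] at h
  let H (p : ℕ) : (cochains B).X (p + 1) ⟶ (cochains B).X p :=
    (h₀.toChainHomotopy.hom p (p + 1)).unop
  cases n with
  | zero =>
    refine ⟨0, 0, ?_⟩
    rw [dNext_eq_zero _ _ (by simp), zero_add] at h
    have h' : 𝟙 ((cochains B).X 0) = (cochains B).d 0 1 ≫ H 0 + 0 := by
      rw [cochains_d]
      exact congrArg Quiver.Hom.unop h
    have h'' : a = H 0 ((cochains B).d 0 1 a) := by
      rw [add_zero] at h'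
      exact ConcreteCategory.congr_hom h' a
    rw [h'', ha, map_zero, map_zero]
  | succ n =>
    refine ⟨n, H n a, ?_⟩
    rw [dNext_eq (i' := n) (w := by simp)] at h
    have h' : 𝟙 ((cochains B).X (n + 1)) = H n ≫ (cochains B).d n (n + 1) +
        (cochains B).d (n + 1) (n + 2) ≫ H (n + 1) + 0 := by
      rw [cochains_d, cochains_d]
      exact congrArg Quiver.Hom.unop h
    have h'' : a = (cochains B).d n (n + 1) (H n a) +
        H (n + 1) ((cochains B).d (n + 1) (n + 2) a) := by
      rw [add_zero] at h'
      exact ConcreteCategory.congr_hom h' a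
    rw [ha, map_zero, add_zero] at h''
    exact h''.symm

lemma isZero_homology_horn (n : ℕ) :
    Limits.IsZero ((cochains (relCochainsObj (hornSieve k) A)).homology n) := by
  refine @AddCommGrpCat.isZero_of_subsingleton _ ?_
  refine subsingleton_of_forall_eq 0 fun y => ?_
  obtain ⟨x, rfl⟩ := cohomologyClass_surjective _ n y
  exact (cohomologyClass_eq_zero_iff _ n x).2 (exists_d_eq_of_homotopy (hornHomotopy A) n x.1 x.2)

end Horn

/-! ### The dimension shift -/

section DimensionShift

/-- The cochains of the simplex `⦋k⦌` relative to its boundary. -/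
abbrev boundaryCochains (k : ℕ) :
    CosimplicialObject AddCommGrpCat.{u} ⥤ CosimplicialObject AddCommGrpCat.{u} :=
  relCochains (boundarySieve k)

/-- The inclusion of the cochains relative to the boundary into those relative to the horn. -/
def boundaryToHorn (k : ℕ) : boundaryCochains.{u} (k + 1) ⟶ relCochains (hornSieve k) :=
  relCochainsRestrict (𝟙 _) fun _ β ⟨i, hi⟩ => ⟨i.castSucc, by rwa [Category.comp_id]⟩

lemma boundarySieve_comp_δ_last (k : ℕ) {c : SimplexCategory} (β : c ⟶ ⦋k⦌)
    (hβ : boundarySieve k β) : hornSieve k (β ≫ SimplexCategory.δ (Fin.last (k + 1))) := by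
  obtain ⟨i, hi⟩ := hβ
  refine ⟨i, fun x h => hi x ?_⟩
  refine Fin.castSucc_injective _ (Eq.trans ?_ h)
  change _ = (Fin.last (k + 1)).succAbove (β x)
  rw [Fin.succAbove_last]

/-- The restriction to the last face of cochains relative to the horn. -/
def hornToBoundary (k : ℕ) : relCochains.{u} (hornSieve k) ⟶ boundaryCochains k :=
  relCochainsRestrict (SimplexCategory.δ (Fin.last (k + 1))) fun _ => boundarySieve_comp_δ_last k

/-- A simplex in the boundary of `⦋k + 1⦌` lies in the horn or in the last face. -/
lemma boundarySieve_succ_cases (k : ℕ) {c : SimplexCategory} {β : c ⟶ ⦋k + 1⦌}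
    (hβ : boundarySieve (k + 1) β) :
    hornSieve k β ∨ ∃ γ, β = γ ≫ SimplexCategory.δ (Fin.last (k + 1)) := by
  obtain ⟨i, hi⟩ := hβ
  induction i using Fin.lastCases with
  | last => exact .inr (SimplexCategory.eq_comp_δ_of_not_surjective' β _ hi)
  | cast i => exact .inl ⟨i, hi⟩

open Classical in
/-- The extension by zero of a cochain on the last face. -/
noncomputable def extendByZero {k : ℕ} {c : SimplexCategory} {M : Type*} [Zero M]
    (a : (c ⟶ ⦋k⦌) → M) (β : c ⟶ ⦋k + 1⦌) : M :=
  if h : ∃ γ, β = γ ≫ SimplexCategory.δ (Fin.last (k + 1)) then a h.choose else 0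

lemma extendByZero_comp_δ {k : ℕ} {c : SimplexCategory} {M : Type*} [Zero M]
    (a : (c ⟶ ⦋k⦌) → M) (γ : c ⟶ ⦋k⦌) :
    extendByZero a (γ ≫ SimplexCategory.δ (Fin.last (k + 1))) = a γ := by
  have h : ∃ γ', γ ≫ SimplexCategory.δ (Fin.last (k + 1)) =
    γ' ≫ SimplexCategory.δ (Fin.last (k + 1)) := ⟨γ, rfl⟩
  rw [extendByZero, dif_pos h]
  exact congrArg a ((cancel_mono _).1 h.choose_spec).symm

lemma extendByZero_eq_zero {k : ℕ} {c : SimplexCategory} {M : Type*} [Zero M]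
    (a : (c ⟶ ⦋k⦌) → M) (β : c ⟶ ⦋k + 1⦌)
    (hβ : ¬ ∃ γ, β = γ ≫ SimplexCategory.δ (Fin.last (k + 1))) : extendByZero a β = 0 :=
  dif_neg hβ

lemma extendByZero_horn {k : ℕ} {c : SimplexCategory} {M : Type*} [Zero M]
    (a : (c ⟶ ⦋k⦌) → M) (ha : ∀ γ, boundarySieve k γ → a γ = 0) (β : c ⟶ ⦋k + 1⦌)
    (hβ : hornSieve k β) : extendByZero a β = 0 := by
  by_cases h : ∃ γ, β = γ ≫ SimplexCategory.δ (Fin.last (k + 1))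
  · obtain ⟨γ, rfl⟩ := h
    rw [extendByZero_comp_δ]
    obtain ⟨i, hi⟩ := hβ
    refine ha _ ⟨i, fun x hx => hi x ?_⟩
    change (Fin.last (k + 1)).succAbove (γ x) = _
    rw [hx, Fin.succAbove_last]
  · exact extendByZero_eq_zero a β h

lemma hornToBoundary_surjective (k : ℕ) (A : CosimplicialObject AddCommGrpCat.{u})
    (c : SimplexCategory) :
    Function.Surjective (((hornToBoundary k).app A).app c) := fun a =>
  ⟨(⟨extendByZero a.1, extendByZero_horn a.1 a.2⟩ : (relCochainsObj (hornSieve k) A).obj c),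
    relCochainsObj_ext fun γ => extendByZero_comp_δ a.1 γ⟩

lemma boundaryToHorn_apply (k : ℕ) (A : CosimplicialObject AddCommGrpCat.{u})
    (c : SimplexCategory) (a : (relCochainsObj (boundarySieve (k + 1)) A).obj c)
    (β : c ⟶ ⦋k + 1⦌) :
    (((boundaryToHorn k).app A).app c a : (relCochainsObj (hornSieve k) A).obj c).1 β = a.1 β :=
  congrArg a.1 (Category.comp_id β)

lemma boundaryToHorn_injective (k : ℕ) (A : CosimplicialObject AddCommGrpCat.{u})
    (c : SimplexCategory) :
    Function.Injective (((boundaryToHorn k).app A).app c) := fun a b h =>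
  relCochainsObj_ext fun β =>
    (boundaryToHorn_apply k A c a β).symm.trans
      ((congrArg (fun (a : (relCochainsObj (hornSieve k) A).obj c) => a.1 β) h).trans
        (boundaryToHorn_apply k A c b β))

lemma hornToBoundary_boundaryToHorn (k : ℕ) (A : CosimplicialObject AddCommGrpCat.{u})
    (c : SimplexCategory) (a : (relCochainsObj (boundarySieve (k + 1)) A).obj c) :
    ((hornToBoundary k).app A).app c (((boundaryToHorn k).app A).app c a) = 0 := by
  refine relCochainsObj_ext fun γ => ?_
  refine (boundaryToHorn_apply k A c a _).trans (a.2 _ ⟨Fin.last (k + 1), fun x => ?_⟩)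
  exact Fin.succAbove_ne _ _

lemma exists_boundaryToHorn_eq (k : ℕ) (A : CosimplicialObject AddCommGrpCat.{u})
    (c : SimplexCategory) (a : (relCochainsObj (hornSieve k) A).obj c)
    (ha : ((hornToBoundary k).app A).app c a = 0) :
    ∃ b, ((boundaryToHorn k).app A).app c b = a := by
  refine ⟨(⟨a.1, fun β hβ => ?_⟩ : (relCochainsObj (boundarySieve (k + 1)) A).obj c),
    relCochainsObj_ext fun β => congrArg a.1 (Category.comp_id β)⟩
  obtain h | ⟨γ, rfl⟩ := boundarySieve_succ_cases k hβ
  · exact a.2 β h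
  · exact congrFun (congrArg Subtype.val ha) γ

/-- The short exact sequence of complexes of cochains relative to the boundary of `⦋k + 1⦌`, to
the horn, and to the boundary of the last face. -/
noncomputable abbrev boundarySequence (k : ℕ) (A : CosimplicialObject AddCommGrpCat.{u}) :
    ShortComplex (CochainComplex AddCommGrpCat.{u} ℕ) :=
  ShortComplex.mk
    ((alternatingCofaceMapComplex _).map ((boundaryToHorn k).app A))
    ((alternatingCofaceMapComplex _).map ((hornToBoundary k).app A)) (by
      ext n a
      exact hornToBoundary_boundaryToHorn k A ⦋n⦌ a)

lemma boundarySequence_shortExact (k : ℕ) (A : CosimplicialObject AddCommGrpCat.{u}) :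
    (boundarySequence k A).ShortExact := by
  refine HomologicalComplex.shortExact_of_degreewise_shortExact _ fun n => ?_
  refine ShortComplex.ShortExact.mk' ?_ ?_ ?_
  · rw [ShortComplex.ab_exact_iff]
    exact exists_boundaryToHorn_eq k A ⦋n⦌
  · exact (AddCommGrpCat.mono_iff_injective _).2 (boundaryToHorn_injective k A ⦋n⦌)
  · exact (AddCommGrpCat.epi_iff_surjective _).2 (hornToBoundary_surjective k A ⦋n⦌)

/-- The morphism of short exact sequences induced by a morphism of coefficients. -/
noncomputable def boundarySequenceMap (k : ℕ) {A A' : CosimplicialObject AddCommGrpCat.{u}}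
    (f : A ⟶ A') : boundarySequence k A ⟶ boundarySequence k A' where
  τ₁ := (alternatingCofaceMapComplex _).map ((boundaryCochains (k + 1)).map f)
  τ₂ := (alternatingCofaceMapComplex _).map ((relCochains (hornSieve k)).map f)
  τ₃ := (alternatingCofaceMapComplex _).map ((boundaryCochains k).map f)
  comm₁₂ := by
    dsimp only [boundarySequence]
    rw [← Functor.map_comp, ← Functor.map_comp, NatTrans.naturality]
  comm₂₃ := by
    dsimp only [boundarySequence]
    rw [← Functor.map_comp, ← Functor.map_comp, NatTrans.naturality]

/-- The connecting isomorphism of the sequence `boundarySequence`, whose middle term is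
acyclic. -/
noncomputable def boundaryShift (k n : ℕ) :
    boundaryCochains.{u} k ⋙ cohomology n ≅ boundaryCochains (k + 1) ⋙ cohomology (n + 1) :=
  NatIso.ofComponents
    (fun A => (boundarySequence_shortExact k A).δIso n (n + 1) (by simp)
      (isZero_homology_horn A n) (isZero_homology_horn A (n + 1)))
    fun {A A'} f => (HomologicalComplex.HomologySequence.δ_naturality (boundarySequenceMap k f)
      (boundarySequence_shortExact k A) (boundarySequence_shortExact k A') n (n + 1) (by simp)).symm

/-- The boundary of `⦋0⦌` is empty, and cochains on the point are just coefficients. -/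
def boundaryCochainsZero : boundaryCochains.{u} 0 ≅ 𝟭 _ :=
  NatIso.ofComponents (fun A => NatIso.ofComponents
    (fun c => AddEquiv.toAddCommGrpIso
      { toFun := fun (a : (relCochainsObj (boundarySieve 0) A).obj c) =>
          a.1 (SimplexCategory.isTerminalZero.from c)
        invFun := fun a => (⟨fun _ => a, fun β ⟨i, hi⟩ =>
            absurd (Subsingleton.elim (α := Fin 1) _ _) (hi 0)⟩ :
          (relCochainsObj (boundarySieve 0) A).obj c)
        left_inv := fun a => relCochainsObj_ext fun β =>
          congrArg a.1 (SimplexCategory.isTerminalZero.hom_ext _ _)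
        right_inv := fun a => rfl
        map_add' := fun a b => rfl })
    fun {c c'} θ => by
      refine AddCommGrpCat.hom_ext (AddMonoidHom.ext fun a => ?_)
      exact congrArg (fun β => A.map θ (a.1 β)) (SimplexCategory.isTerminalZero.hom_ext _ _))
    fun _ => rfl

/-- The cohomology of the simplex relative to its boundary is the cohomology of the
coefficients, shifted by the dimension. -/
noncomputable def boundaryCohomology (p k : ℕ) :
    boundaryCochains.{u} k ⋙ cohomology (p + k) ≅ cohomology p :=
  match k with
  | 0 => Functor.isoWhiskerRight boundaryCochainsZero _ ≪≫ Functor.leftUnitor _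
  | k + 1 => (boundaryShift k (p + k)).symm ≪≫ boundaryCohomology p k

end DimensionShift

/-! ### Homotopy groups of a simplicial abelian group in terms of elements -/

section Elements

variable {G : SimplicialObject AddCommGrpCat.{u}}

/-- The Yoneda bijection for the underlying simplicial set of a simplicial abelian group is
additive. -/
def simplexEquiv (m : SimplexCategory) :
    (SSet.stdSimplex.{u}.obj m ⟶ toSSet G) ≃+ G.obj (op m) where
  toEquiv := SSet.yonedaEquiv
  map_add' _ _ := rfl

lemma app_eq_map_simplexEquiv {m : SimplexCategory} (f : SSet.stdSimplex.{u}.obj m ⟶ toSSet G)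
    {c : SimplexCategory} (s : (SSet.stdSimplex.{u}.obj m).obj (op c)) :
    (f.app (op c) s : G.obj (op c)) =
      G.map (SSet.stdSimplex.objEquiv s).op (simplexEquiv m f) := by
  obtain ⟨x, rfl⟩ := SSet.yonedaEquiv.symm.surjective f
  change _ = G.map (SSet.stdSimplex.objEquiv s).op
    (SSet.yonedaEquiv (X := toSSet G) (SSet.yonedaEquiv.symm x))
  rw [Equiv.apply_symm_apply]
  rfl

lemma simplexEquiv_map_comp {m m' : SimplexCategory} (φ : m' ⟶ m)
    (f : SSet.stdSimplex.{u}.obj m ⟶ toSSet G) :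
    simplexEquiv m' (SSet.stdSimplex.map φ ≫ f) = G.map φ.op (simplexEquiv m f) :=
  (SSet.yonedaEquiv_naturality φ f).symm

lemma boundarySieve_iff {k : ℕ} {c : SimplexCategory} (β : c ⟶ ⦋k⦌) :
    boundarySieve k β ↔ ¬ Function.Surjective β := by
  simp only [Function.Surjective, not_forall, not_exists]
  rfl

lemma boundary_comp_eq_zero_iff {k : ℕ} (f : Δ[k] ⟶ toSSet G) :
    (SSet.boundary k).ι ≫ f = 0 ↔
      ∀ (c : SimplexCategory) (β : c ⟶ ⦋k⦌), boundarySieve k β →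
        G.map β.op (simplexEquiv ⦋k⦌ f) = 0 := by
  constructor
  · intro h c β hβ
    have hs : SSet.stdSimplex.objEquiv.symm β ∈ (SSet.boundary.{u} k).obj (op c) :=
      (boundarySieve_iff β).1 hβ
    have := ConcreteCategory.congr_hom (congrArg (fun φ => φ.app (op c)) h) ⟨_, hs⟩
    exact (app_eq_map_simplexEquiv f _).symm.trans this
  · intro h
    refine map_ext fun ⟨c⟩ ⟨s, hs⟩ => ?_
    exact (app_eq_map_simplexEquiv f s).trans (h _ _ ((boundarySieve_iff _).2 hs))

/-- A cycle is zero in the homotopy group if and only if it is the last face of a simplex all of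
whose other faces vanish. -/
lemma homotopyClass_eq_zero_iff {k : ℕ} (g : Cycle G k) :
    homotopyClass g = 0 ↔ ∃ r : G.obj (op ⦋k + 1⦌),
      (∀ i : Fin (k + 1), G.δ i.castSucc r = 0) ∧
      G.δ (Fin.last (k + 1)) r = simplexEquiv ⦋k⦌ g.map := by
  rw [eq_comm]
  refine (homotopyClass_eq_iff 0 g).trans ⟨?_, ?_⟩
  · rintro ⟨r⟩
    refine ⟨simplexEquiv _ r.map, fun i => ?_, ?_⟩
    · refine (simplexEquiv_map_comp (SimplexCategory.δ i.castSucc) r.map).symm.trans ?_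
      rw [← (simplexEquiv (G := G) ⦋k⦌).map_zero]
      refine congrArg (simplexEquiv (G := G) ⦋k⦌) ?_
      obtain h | h := (Fin.le_last i).eq_or_lt
      · subst h
        exact r.δ_castSucc_map
      · exact (r.δ_map_of_lt i.castSucc (Fin.castSucc_lt_castSucc_iff.2 h)).trans const_basePt
    · refine (simplexEquiv_map_comp (SimplexCategory.δ (Fin.last _)) r.map).symm.trans ?_
      exact congrArg (simplexEquiv (G := G) ⦋k⦌) r.δ_succ_map
  · rintro ⟨r, h, h'⟩
    have key (i : Fin (k + 2)) : simplexEquiv ⦋k⦌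
        (SSet.stdSimplex.map (SimplexCategory.δ i) ≫ (simplexEquiv ⦋k + 1⦌).symm r) =
          G.δ i r := by
      rw [simplexEquiv_map_comp, AddEquiv.apply_symm_apply]
      rfl
    have key' (i : Fin (k + 1)) : SSet.stdSimplex.map (SimplexCategory.δ i.castSucc) ≫
        (simplexEquiv ⦋k + 1⦌).symm r = 0 :=
      (simplexEquiv (G := G) ⦋k⦌).injective (((key _).trans (h i)).trans
        (simplexEquiv (G := G) ⦋k⦌).map_zero.symm)
    exact ⟨{
      map := (simplexEquiv ⦋k + 1⦌).symm r
      δ_castSucc_map := key' _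
      δ_succ_map := (simplexEquiv (G := G) ⦋k⦌).injective ((key _).trans h')
      δ_map_of_lt := fun j hj => by
        rw [const_basePt]
        obtain ⟨i, rfl⟩ := Fin.eq_castSucc_of_ne_last (hj.trans (Fin.castSucc_lt_last _)).ne
        exact key' i
      δ_map_of_gt := fun j hj => absurd (Fin.le_last j) (by simpa using hj) }⟩

end Elements

/-! ### Simplicial groups of normalized cocycles -/

section Cocycles

variable (n : ℕ)

/-- The group of normalized `n`-cocycles on the simplex `m` with coefficients in the cosimplicial
abelian group `A`, as functions on all `n`-simplices. As in `normalized`, the normalization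
condition is stated for all maps which lower the degree. -/
def normalizedCocycles (A : CosimplicialObject AddCommGrpCat.{u}) (m : SimplexCategory) :
    AddSubgroup ((⦋n⦌ ⟶ m) → A.obj ⦋n⦌) where
  carrier := {a | (∀ p < n, ∀ (σ : ⦋n⦌ ⟶ ⦋p⦌) (β : ⦋p⦌ ⟶ m), A.map σ (a (σ ≫ β)) = 0) ∧
    ∀ β : ⦋n + 1⦌ ⟶ m, ∑ i : Fin (n + 2),
      (-1 : ℤ) ^ (i : ℕ) • A.δ i (a (SimplexCategory.δ i ≫ β)) = 0}
  zero_mem' := ⟨fun p _ σ _ => map_zero (A.map σ).hom, fun β =>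
    Finset.sum_eq_zero fun i _ =>
      (congrArg ((-1 : ℤ) ^ (i : ℕ) • ·) (map_zero (A.δ i).hom)).trans (smul_zero _)⟩
  add_mem' {a b} ha hb := ⟨fun p hp σ β => by
      rw [Pi.add_apply, map_add, ha.1 p hp, hb.1 p hp, add_zero], fun β => by
      simp only [Pi.add_apply, map_add, smul_add, Finset.sum_add_distrib]
      rw [ha.2, hb.2, add_zero]⟩
  neg_mem' {a} ha := ⟨fun p hp σ β => by
      rw [Pi.neg_apply, map_neg, ha.1 p hp, neg_zero], fun β => by
      simp only [Pi.neg_apply, map_neg, smul_neg, Finset.sum_neg_distrib]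
      rw [ha.2, neg_zero]⟩

/-- The simplicial abelian group of normalized cocycles on the simplices. -/
def normalizedCocyclesObj (A : CosimplicialObject AddCommGrpCat.{u}) :
    SimplicialObject AddCommGrpCat.{u} where
  obj m := AddCommGrpCat.of (normalizedCocycles n A m.unop)
  map φ := AddCommGrpCat.ofHom <| AddMonoidHom.mk'
    (fun a => ⟨fun β => a.1 (β ≫ φ.unop), fun p hp σ β =>
      (congrArg (fun γ => A.map σ (a.1 γ)) (Category.assoc σ β φ.unop)).trans (a.2.1 p hp σ _),
      fun β => by
        simp only [Category.assoc]
        exact a.2.2 _⟩)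
    fun _ _ => rfl
  map_id m := by
    refine AddCommGrpCat.hom_ext (AddMonoidHom.ext fun a => Subtype.ext (funext fun β => ?_))
    exact congrArg a.1 (Category.comp_id β)
  map_comp φ ψ := by
    refine AddCommGrpCat.hom_ext (AddMonoidHom.ext fun a => Subtype.ext (funext fun β => ?_))
    exact congrArg a.1 (Category.assoc _ _ _).symm

lemma normalizedCocyclesObj_ext {A : CosimplicialObject AddCommGrpCat.{u}}
    {m : SimplexCategoryᵒᵖ} {a b : (normalizedCocyclesObj n A).obj m} (h : ∀ β, a.1 β = b.1 β) :
    a = b :=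
  Subtype.ext (funext h)

/-- The simplicial abelian group of normalized cocycles, as a functor of the coefficients. -/
def normalizedCocyclesFunctor :
    CosimplicialObject AddCommGrpCat.{u} ⥤ SimplicialObject AddCommGrpCat.{u} where
  obj A := normalizedCocyclesObj n A
  map {A A'} f :=
    { app := fun m => AddCommGrpCat.ofHom <| AddMonoidHom.mk'
        (fun (a : (normalizedCocyclesObj n A).obj m) =>
          (⟨fun β => f.app ⦋n⦌ (a.1 β), fun p hp σ β =>
            (ConcreteCategory.congr_hom (f.naturality σ) (a.1 (σ ≫ β))).symm.trans
              ((congrArg (f.app ⦋p⦌) (a.2.1 p hp σ β)).trans (map_zero (f.app ⦋p⦌).hom)),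
            fun β => by
              have h : f.app ⦋n + 1⦌ _ = 0 := (congrArg (f.app ⦋n + 1⦌) (a.2.2 β)).trans
                (map_zero (f.app ⦋n + 1⦌).hom)
              rw [map_sum] at h
              refine Eq.trans (Finset.sum_congr rfl fun i _ => ?_) h
              rw [map_zsmul]
              exact congrArg ((-1 : ℤ) ^ (i : ℕ) • ·) (ConcreteCategory.congr_hom
                (f.naturality (SimplexCategory.δ i)) (a.1 (SimplexCategory.δ i ≫ β))).symm⟩ :
            (normalizedCocyclesObj n A').obj m))
        fun a b => normalizedCocyclesObj_ext n fun β => map_add (f.app ⦋n⦌).hom _ _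
      naturality := fun _ _ _ => rfl }

end Cocycles

/-! ### Homotopy groups of the simplicial group of normalized cocycles -/

section CocycleHomotopy

variable {n : ℕ} {A : CosimplicialObject AddCommGrpCat.{u}}

lemma relCochains_d_apply {m : SimplexCategory} (S : Sieve m)
    (a : (relCochainsObj S A).obj ⦋n⦌) (β : ⦋n + 1⦌ ⟶ m) :
    ((cochains (relCochainsObj S A)).d n (n + 1) a : (relCochainsObj S A).obj ⦋n + 1⦌).1 β =
      ∑ i : Fin (n + 2), (-1 : ℤ) ^ (i : ℕ) • A.δ i (a.1 (SimplexCategory.δ i ≫ β)) := by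
  let ev : (relCochainsObj S A).obj ⦋n + 1⦌ →+ A.obj ⦋n + 1⦌ :=
    AddMonoidHom.mk' (fun b => b.1 β) fun _ _ => rfl
  change ev ((cochains (relCochainsObj S A)).d n (n + 1) a) = _
  rw [cochains_d_apply, map_sum]
  exact Finset.sum_congr rfl fun i _ => map_zsmul ev _ _

/-- A relative cochain satisfies the explicit conditions of `normalizedCocycles` if and only if it
is a normalized cocycle of the cosimplicial group of relative cochains. -/
lemma mem_normalizedCocycles_iff {m : SimplexCategory} (S : Sieve m)
    (a : (relCochainsObj S A).obj ⦋n⦌) :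
    a.1 ∈ normalizedCocycles n A m ↔ a ∈ normalized (relCochainsObj S A) n ∧
      (cochains (relCochainsObj S A)).d n (n + 1) a = 0 := by
  refine and_congr ?_ ?_
  · exact ⟨fun h p hp σ => relCochainsObj_ext fun β => h p hp σ β,
      fun h p hp σ β => congrFun (congrArg Subtype.val (h p hp σ)) β⟩
  · exact ⟨fun h => relCochainsObj_ext fun β => (relCochains_d_apply S a β).trans (h β),
      fun h β => (relCochains_d_apply S a β).symm.trans (congrFun (congrArg Subtype.val h) β)⟩

variable (n A) in
/-- The values of a cycle. -/
def cycleValue {k : ℕ} (f : Cycle (normalizedCocyclesObj n A) k) : normalizedCocycles n A ⦋k⦌ :=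
  simplexEquiv ⦋k⦌ f.map

lemma cycleValue_boundary {k : ℕ} (f : Cycle (normalizedCocyclesObj n A) k)
    (β : ⦋n⦌ ⟶ ⦋k⦌) (hβ : boundarySieve k β) : (cycleValue n A f).1 β = 0 := by
  have h := (boundary_comp_eq_zero_iff f.map).1 f.comm_zero _ β hβ
  have h' := congrFun (congrArg Subtype.val h) (𝟙 _)
  exact (congrArg (cycleValue n A f).1 (Category.id_comp β)).symm.trans h'

lemma exists_cycleValue_eq {k : ℕ} (a : normalizedCocycles n A ⦋k⦌)
    (ha : ∀ β, boundarySieve k β → a.1 β = 0) :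
    ∃ f : Cycle (normalizedCocyclesObj n A) k, cycleValue n A f = a := by
  have h := (simplexEquiv (G := normalizedCocyclesObj n A) ⦋k⦌).apply_symm_apply a
  refine ⟨Cycle.mk ((simplexEquiv ⦋k⦌).symm a) ?_, h⟩
  rw [boundary_comp_eq_zero_iff, h]
  exact fun c β hβ => normalizedCocyclesObj_ext n fun γ =>
    ha _ ((boundarySieve k).downward_closed hβ γ)

lemma cycleValue_injective {k : ℕ} :
    Function.Injective (cycleValue n A : Cycle (normalizedCocyclesObj n A) k → _) := fun _ _ h =>
  SSet.RelativeMorphism.ext ((simplexEquiv (G := normalizedCocyclesObj n A) ⦋k⦌).injective h)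

variable (n A) in
/-- A cycle, as a cocycle relative to the boundary. -/
def cycleToRel (k : ℕ) : Cycle (normalizedCocyclesObj n A) k →+
    ((cochains (relCochainsObj (boundarySieve k) A)).d n (n + 1)).hom.ker :=
  AddMonoidHom.mk' (fun f => ⟨(⟨(cycleValue n A f).1, cycleValue_boundary f⟩ :
    (relCochainsObj (boundarySieve k) A).obj ⦋n⦌),
      ((mem_normalizedCocycles_iff (boundarySieve k) _).1 (cycleValue n A f).2).2⟩)
    fun _ _ => rfl

/-- `homotopyClass_eq_zero_iff` in terms of cocycles relative to the horn. -/
lemma homotopyClass_eq_zero_iff_cycleValue {k : ℕ} (g : Cycle (normalizedCocyclesObj n A) k) :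
    homotopyClass g = 0 ↔ ∃ r : normalizedCocycles n A ⦋k + 1⦌,
      (∀ β, hornSieve k β → r.1 β = 0) ∧
      ∀ γ, r.1 (γ ≫ SimplexCategory.δ (Fin.last (k + 1))) = (cycleValue n A g).1 γ := by
  refine (homotopyClass_eq_zero_iff g).trans (exists_congr fun r => and_congr ?_ ?_)
  · constructor
    · rintro h β ⟨i, hi⟩
      obtain ⟨γ, rfl⟩ := SimplexCategory.eq_comp_δ_of_not_surjective' β _ hi
      exact congrFun (congrArg Subtype.val (h i)) γ
    · intro h i
      refine normalizedCocyclesObj_ext n fun γ => ?_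
      exact h (γ ≫ SimplexCategory.δ i.castSucc) ⟨i, fun x => Fin.succAbove_ne _ _⟩
  · exact ⟨fun h γ => congrFun (congrArg Subtype.val h) γ,
      fun h => normalizedCocyclesObj_ext n h⟩

variable (n A) in
/-- The class of a cycle in the cohomology of the simplex relative to its boundary. -/
noncomputable def cycleClass (k : ℕ) : Cycle (normalizedCocyclesObj n A) k →+
    (cochains (relCochainsObj (boundarySieve k) A)).homology n :=
  (cohomologyClass _ n).comp (cycleToRel n A k)

/-- Every class is represented by a cycle, namely by the normalization of a representative. -/
lemma cycleClass_surjective (k : ℕ) : Function.Surjective (cycleClass n A k) := by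
  intro y
  let B := relCochainsObj (boundarySieve k) A
  obtain ⟨⟨x, hx⟩, rfl⟩ := cohomologyClass_surjective (cochains B) n y
  have hd : (cochains B).d n (n + 1) (normalize B n x) = 0 :=
    (d_normalize B n x).trans ((congrArg (normalize B (n + 1)) hx).trans
      (map_zero (normalize B (n + 1)).hom))
  have hx' := (mem_normalizedCocycles_iff (boundarySieve k) (normalize B n x)).2
    ⟨normalize_mem B n x, hd⟩
  obtain ⟨f, hf⟩ := exists_cycleValue_eq ⟨_, hx'⟩ (normalize B n x).2
  have hf' : cycleToRel n A k f = ⟨normalize B n x, hd⟩ :=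
    Subtype.ext (relCochainsObj_ext fun β => congrFun (congrArg Subtype.val hf) β)
  refine ⟨f, sub_eq_zero.1 ?_⟩
  change cohomologyClass _ n (cycleToRel n A k f) - _ = 0
  rw [hf', ← map_sub, cohomologyClass_eq_zero_iff]
  exact exists_d_eq_sub_normalize B n x hx

/-- Extension by zero preserves normalization: a degeneracy of a simplex lies in the last face
only if the simplex itself does. -/
lemma extendByZero_normalized {k : ℕ} (y : (relCochainsObj (boundarySieve k) A).obj ⦋n⦌)
    (hy : y ∈ normalized (relCochainsObj (boundarySieve k) A) n) {p : ℕ} (hp : p < n)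
    (σ : ⦋n⦌ ⟶ ⦋p⦌) (β : ⦋p⦌ ⟶ ⦋k + 1⦌) : A.map σ (extendByZero y.1 (σ ≫ β)) = 0 := by
  by_cases h : ∃ γ, σ ≫ β = γ ≫ SimplexCategory.δ (Fin.last (k + 1))
  · obtain ⟨γ, hγ⟩ := h
    obtain ⟨n, rfl⟩ := Nat.exists_eq_succ_of_ne_zero (by lia : n ≠ 0)
    obtain ⟨i, τ, rfl⟩ := SimplexCategory.eq_σ_comp_of_not_injective σ (fun hσ => by
      have : Mono σ := SimplexCategory.mono_iff_injective.2 hσ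
      have := SimplexCategory.len_le_of_mono σ
      simp at this
      lia)
    have hlast : ∀ x, (τ ≫ β) x ≠ Fin.last (k + 1) := by
      intro x hx
      obtain ⟨z, rfl⟩ := SimplexCategory.epi_iff_surjective.1
        (inferInstance : Epi (SimplexCategory.σ i)) x
      have := congrArg (fun φ : ⦋n + 1⦌ ⟶ ⦋k + 1⦌ => φ z) hγ
      exact Fin.succAbove_ne _ _ (this.symm.trans hx)
    obtain ⟨γ', hγ'⟩ := SimplexCategory.eq_comp_δ_of_not_surjective' (τ ≫ β) _ hlast
    rw [Category.assoc, hγ', ← Category.assoc, extendByZero_comp_δ, A.map_comp]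
    have := congrFun (congrArg Subtype.val (hy n (by lia) (SimplexCategory.σ i))) γ'
    exact (congrArg (A.map τ) this).trans (map_zero (A.map τ).hom)
  · rw [extendByZero_eq_zero _ _ h, map_zero]

/-- The class of a cycle in relative cohomology vanishes if and only if its homotopy class does. -/
lemma cycleClass_eq_zero_iff {k : ℕ} (f : Cycle (normalizedCocyclesObj n A) k) :
    cycleClass n A k f = 0 ↔ homotopyClass f = 0 := by
  let B := relCochainsObj (boundarySieve k) A
  let B' := relCochainsObj (hornSieve k) A
  let π : cochains B' ⟶ cochains B := (boundarySequence k A).g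
  rw [homotopyClass_eq_zero_iff_cycleValue]
  refine (cohomologyClass_eq_zero_iff _ n (cycleToRel n A k f)).trans ⟨?_, ?_⟩
  · -- If the cocycle is the coboundary of `y`, normalize `y` and extend it by zero to a cochain
    -- relative to the horn; the coboundary of the extension is the required cocycle.
    rintro ⟨i, y, hy⟩
    by_cases hi : i + 1 = n
    · subst hi
      have hf := (mem_normalizedCocycles_iff (boundarySieve k) (cycleToRel (i + 1) A k f).1).1
        (cycleValue (i + 1) A f).2
      let y' := normalize B i y
      have hy' : (cochains B).d i (i + 1) y' = (cycleToRel (i + 1) A k f).1 :=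
        (d_normalize B i y).trans ((congrArg (normalize B (i + 1)) hy).trans
          (normalize_eq_self B (i + 1) hf.1))
      let z : B'.obj ⦋i⦌ := ⟨extendByZero y'.1, extendByZero_horn y'.1 y'.2⟩
      have hz : π.f i z = y' := relCochainsObj_ext fun γ => extendByZero_comp_δ y'.1 γ
      let r : B'.obj ⦋i + 1⦌ := (cochains B').d i (i + 1) z
      have hr : r.1 ∈ normalizedCocycles (i + 1) A ⦋k + 1⦌ := by
        refine (mem_normalizedCocycles_iff (hornSieve k) r).2 ⟨?_, ?_⟩
        · have hz' : normalize B' i z = z := normalize_eq_self B' i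
            fun p hp σ => relCochainsObj_ext fun β =>
              extendByZero_normalized y' (normalize_mem B i y) hp σ β
          have : r = normalize B' (i + 1) r :=
            (congrArg ((cochains B').d i (i + 1)) hz').symm.trans (d_normalize B' i z)
          rw [this]
          exact normalize_mem B' (i + 1) r
        · exact ConcreteCategory.congr_hom ((cochains B').d_comp_d i (i + 1) (i + 2)) z
      refine ⟨⟨r.1, hr⟩, r.2, fun γ => ?_⟩
      have h : π.f (i + 1) r = (cycleToRel (i + 1) A k f).1 :=
        (ConcreteCategory.congr_hom (π.comm i (i + 1)) z).symm.trans
          ((congrArg ((cochains B).d i (i + 1)) hz).trans hy')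
      exact congrFun (congrArg Subtype.val h) γ
    · -- The differential between nonconsecutive degrees is zero, hence so is the cocycle.
      rw [(cochains B).shape i n (by simpa using hi)] at hy
      exact ⟨0, fun _ _ => rfl, fun γ => congrFun (congrArg Subtype.val hy) γ⟩
  · -- A cocycle relative to the horn is a coboundary, and so is its restriction to the last face.
    rintro ⟨r, hr, hr'⟩
    let r' : B'.obj ⦋n⦌ := ⟨r.1, hr⟩
    obtain ⟨i, y, hy⟩ := exists_d_eq_of_homotopy (hornHomotopy A) n r'
      ((mem_normalizedCocycles_iff (hornSieve k) r').1 r.2).2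
    refine ⟨i, π.f i y, ?_⟩
    have h : π.f n r' = (cycleToRel n A k f).1 := relCochainsObj_ext hr'
    exact (ConcreteCategory.congr_hom (π.comm i n) y).trans ((congrArg (π.f n) hy).trans h)

lemma cycleClass_eq_iff {k : ℕ} (f g : Cycle (normalizedCocyclesObj n A) k) :
    cycleClass n A k f = cycleClass n A k g ↔ homotopyClass f = homotopyClass g := by
  have h := cycleClass_eq_zero_iff (f + -g)
  rw [map_add, map_neg, add_neg_eq_zero] at h
  refine h.trans ?_
  change homotopyClass f + -homotopyClass g = 0 ↔ _
  rw [add_neg_eq_zero]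

variable (n A) in
/-- The homomorphism induced by `cycleClass` on the homotopy group. -/
noncomputable def homotopyToCohomology (k : ℕ) :
    HomotopySet (toSSet (normalizedCocyclesObj n A)) k (basePt _) →+
      (cochains (relCochainsObj (boundarySieve k) A)).homology n where
  toFun := Quot.lift (cycleClass n A k) fun f g h => (cycleClass_eq_iff f g).2 (Quot.sound h)
  map_zero' := map_zero (cycleClass n A k)
  map_add' := by
    rintro ⟨f⟩ ⟨g⟩
    exact map_add (cycleClass n A k) f g

lemma homotopyToCohomology_bijective (k : ℕ) :
    Function.Bijective (homotopyToCohomology n A k) := by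
  constructor
  · rintro ⟨f⟩ ⟨g⟩ h
    exact (cycleClass_eq_iff f g).1 h
  · intro y
    obtain ⟨f, rfl⟩ := cycleClass_surjective k y
    exact ⟨homotopyClass f, rfl⟩

variable (n) in
/-- The homotopy groups of the simplicial group of normalized cocycles are the cohomology groups
of the simplices relative to their boundaries. -/
noncomputable def homotopyIso (k : ℕ) :
    normalizedCocyclesFunctor.{u} n ⋙ homotopyGroupFunctor k ≅
      boundaryCochains k ⋙ cohomology n :=
  NatIso.ofComponents (fun A => (AddEquiv.ofBijective (homotopyToCohomology n A k)
      (homotopyToCohomology_bijective k)).toAddCommGrpIso) fun {A A'} φ => by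
    refine AddCommGrpCat.hom_ext (AddMonoidHom.ext ?_)
    rintro ⟨f⟩
    exact (homologyMap_cohomologyClass n
      ((alternatingCofaceMapComplex _).map ((boundaryCochains k).map φ)) (cycleToRel n A k f)
      (cycleToRel n A' k (Cycle.mapHom ((normalizedCocyclesFunctor n).map φ) f)).2).symm

lemma subsingleton_homotopy {k : ℕ} (h : n < k) :
    Subsingleton (HomotopySet (toSSet (normalizedCocyclesObj n A)) k (basePt _)) := by
  refine ⟨?_⟩
  have (f g : Cycle (normalizedCocyclesObj n A) k) : f = g :=
    cycleValue_injective (Subtype.ext (funext fun β => by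
      have hβ : boundarySieve k β := (boundarySieve_iff β).2 fun hs => by
        have : Epi β := SimplexCategory.epi_iff_surjective.2 hs
        have := SimplexCategory.len_le_of_epi β
        simp at this
        lia
      rw [cycleValue_boundary f β hβ, cycleValue_boundary g β hβ]))
  rintro ⟨f⟩ ⟨g⟩
  rw [this f g]

end CocycleHomotopy

/-! ### Eilenberg-Mac Lane groups as groups of normalized cocycles -/

section EilenbergMacLane

variable (n : ℕ)

/-- The functor which sends an abelian group `M` to the simplicial abelian group of normalized
`n`-cocycles on the simplices with values in `M`. -/
def cocycleModel : AddCommGrpCat.{u} ⥤ SimplicialObject AddCommGrpCat.{u} :=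
  Functor.const SimplexCategory ⋙ normalizedCocyclesFunctor n

variable {n} {M : AddCommGrpCat.{u}} {m : ℕ}

/-- A simplex of the model in degree `m`, as a function. -/
abbrev modelValue {m : ℕ} (a : ((cocycleModel n).obj M).obj (op ⦋m⦌)) (β : ⦋n⦌ ⟶ ⦋m⦌) : M := a.1 β

lemma modelValue_eq_zero_of_not_injective (a : ((cocycleModel n).obj M).obj (op ⦋m⦌))
    (β : ⦋n⦌ ⟶ ⦋m⦌) (hβ : ¬ Function.Injective β) : modelValue a β = 0 := by
  cases n with
  | zero => exact absurd (Function.injective_of_subsingleton (α := Fin 1) _) hβ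
  | succ n =>
    obtain ⟨i, τ, rfl⟩ := SimplexCategory.eq_σ_comp_of_not_injective β hβ
    exact a.2.1 n (by lia) (SimplexCategory.σ i) τ

/-- The condition that all faces but the zeroth one vanish, stated for the values: the simplices
which miss some vertex `i ≠ 0` are those in the `i`-th face. -/
def HigherFacesZero (a : ((cocycleModel n).obj M).obj (op ⦋m⦌)) : Prop :=
  ∀ (β : ⦋n⦌ ⟶ ⦋m⦌) (i : Fin (m + 1)), i ≠ 0 → (∀ x, β x ≠ i) → modelValue a β = 0

/-- Outside degree `n`, a simplex of the model vanishes if its faces other than the zeroth one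
vanish: an injective `β` which hits all vertices but possibly `0` must be `δ 0`, and the
value there is determined by the cocycle condition. -/
lemma HigherFacesZero.eq_zero_of_ne {a : ((cocycleModel n).obj M).obj (op ⦋m⦌)}
    (ha : HigherFacesZero a) (hm : m ≠ n) (β : ⦋n⦌ ⟶ ⦋m⦌) : modelValue a β = 0 := by
  by_cases hβ : Function.Injective β
  · by_cases h : ∃ i : Fin (m + 1), i ≠ 0 ∧ ∀ x, β x ≠ i
    · obtain ⟨i, hi, hi'⟩ := h
      exact ha β i hi hi'
    · push Not at h
      have hmono : Mono β := SimplexCategory.mono_iff_injective.2 hβ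
      have hnm : n ≤ m := SimplexCategory.len_le_of_mono β
      obtain ⟨m, rfl⟩ := Nat.exists_eq_succ_of_ne_zero (by lia : m ≠ 0)
      have h₀ : ∀ x, β x ≠ 0 := by
        intro x hx
        have : Epi β := SimplexCategory.epi_iff_surjective.2 fun i => by
          by_cases hi : i = 0
          · exact ⟨x, hx.trans hi.symm⟩
          · exact h i hi
        have : m + 1 ≤ n := SimplexCategory.len_le_of_epi β
        lia
      obtain ⟨γ, rfl⟩ := SimplexCategory.eq_comp_δ_of_not_surjective' β 0 h₀
      have hγ : Epi γ := SimplexCategory.epi_iff_surjective.2 fun i => by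
        obtain ⟨x, hx⟩ := h i.succ (Fin.succ_ne_zero i)
        exact ⟨x, Fin.succ_injective _ hx⟩
      have hγ' : Mono γ := mono_of_mono γ (SimplexCategory.δ 0)
      obtain rfl : m = n := le_antisymm (SimplexCategory.len_le_of_epi γ)
        (SimplexCategory.len_le_of_mono γ)
      obtain rfl := SimplexCategory.eq_id_of_mono γ
      -- The remaining case is `β = δ 0`: the cocycle condition at the nondegenerate simplex
      -- expresses the value at `δ 0` by the values at the other faces, which vanish.
      have hc := a.2.2 (𝟙 _)
      rw [Finset.sum_eq_single 0] at hc
      · have hc' : (-1 : ℤ) ^ 0 • modelValue a (SimplexCategory.δ 0 ≫ 𝟙 _) = 0 := hc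
        rw [pow_zero, one_smul, Category.comp_id] at hc'
        rwa [Category.id_comp]
      · intro i _ hi
        have : modelValue a (SimplexCategory.δ i ≫ 𝟙 _) = 0 := ha _ i hi fun x => by
          rw [Category.comp_id]
          exact Fin.succAbove_ne _ _
        exact (congrArg ((-1 : ℤ) ^ (i : ℕ) • ·) this).trans (smul_zero _)
      · exact fun h => absurd (Finset.mem_univ _) h
  · exact modelValue_eq_zero_of_not_injective a β hβ

lemma modelValue_eq_zero_of_ne_id (a : ((cocycleModel n).obj M).obj (op ⦋n⦌))
    (β : ⦋n⦌ ⟶ ⦋n⦌) (hβ : β ≠ 𝟙 _) : modelValue a β = 0 := by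
  refine modelValue_eq_zero_of_not_injective a β fun h => hβ ?_
  have : Mono β := SimplexCategory.mono_iff_injective.2 h
  exact SimplexCategory.eq_id_of_mono β

lemma δ_comp_σ_eq_id_iff (i : Fin (n + 2)) (j : Fin (n + 1)) :
    SimplexCategory.δ i ≫ SimplexCategory.σ j = 𝟙 _ ↔ i = j.castSucc ∨ i = j.succ := by
  constructor
  · intro h
    have h' (x : Fin (n + 1)) : (SimplexCategory.σ j (SimplexCategory.δ i x)).val = x.val :=
      congrArg (fun φ : ⦋n⦌ ⟶ ⦋n⦌ => (φ x).val) h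
    simp only [σ_val, δ_val] at h'
    simp only [Fin.ext_iff, Fin.val_castSucc, Fin.val_succ]
    by_contra! hij
    rcases lt_or_ge i.val j.val with hlt | hge
    · have := h' ⟨i.val, by lia⟩
      simp only at this
      split_ifs at this <;> lia
    · have := h' ⟨i.val - 1, by lia⟩
      simp only at this
      split_ifs at this <;> lia
  · rintro (rfl | rfl)
    · exact SimplexCategory.δ_comp_σ_self
    · exact SimplexCategory.δ_comp_σ_succ

variable (n M) in
/-- The simplices of the model in degree `n`: the value at the nondegenerate `n`-simplex is
arbitrary. -/
def fundamentalSimplex (x : M) : ((cocycleModel n).obj M).obj (op ⦋n⦌) :=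
  (⟨fun β => if β = 𝟙 _ then x else 0, fun p hp σ β => by
      have : σ ≫ β ≠ 𝟙 _ := fun h => by
        have : Mono (σ ≫ β) := h ▸ inferInstance
        have : Mono σ := mono_of_mono σ β
        have : n ≤ p := SimplexCategory.len_le_of_mono σ
        lia
      exact if_neg this, fun β => by
      change ∑ i : Fin (n + 2), (-1 : ℤ) ^ (i : ℕ) •
        (if SimplexCategory.δ i ≫ β = 𝟙 _ then x else 0 : M) = 0
      by_cases h : Epi β
      · -- The simplex `σ j` has exactly two nondegenerate faces, with opposite signs.
        obtain ⟨j, rfl⟩ := SimplexCategory.eq_σ_of_epi β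
        simp only [δ_comp_σ_eq_id_iff]
        rw [Fintype.sum_eq_add j.castSucc j.succ (Fin.castSucc_lt_succ).ne]
        · simp [pow_succ]
        · rintro i ⟨hi, hi'⟩
          rw [if_neg (by simp [hi, hi']), smul_zero]
      · refine Finset.sum_eq_zero fun i _ => ?_
        rw [if_neg, smul_zero]
        intro h'
        have : Epi (SimplexCategory.δ i ≫ β) := h' ▸ inferInstance
        exact h (epi_of_epi (SimplexCategory.δ i) β)⟩ :
    (normalizedCocyclesObj n ((Functor.const _).obj M)).obj (op ⦋n⦌))

open NormalizedMooreComplex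

lemma higherFacesZero_arrow (x : (objX ((cocycleModel n).obj M) m : AddCommGrpCat.{u})) :
    HigherFacesZero ((objX ((cocycleModel n).obj M) m).arrow x) := by
  intro β i hi hβ
  cases m with
  | zero => exact absurd (Subsingleton.elim (α := Fin 1) _ _) hi
  | succ m =>
    obtain ⟨i, rfl⟩ := Fin.exists_succ_eq.2 hi
    obtain ⟨γ, rfl⟩ := SimplexCategory.eq_comp_δ_of_not_surjective' β _ hβ
    have h : (objX ((cocycleModel n).obj M) (m + 1)).arrow ≫
        ((cocycleModel n).obj M).δ i.succ = 0 := by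
      have := DoldKan.HigherFacesVanish.inclusionOfMooreComplexMap
        (X := (cocycleModel n).obj M) m i (by lia)
      rwa [inclusionOfMooreComplexMap_f] at this
    have h' := ConcreteCategory.congr_hom h x
    exact congrFun (congrArg Subtype.val h') γ

/-- The evaluation at the nondegenerate simplex. -/
def evalId (M : AddCommGrpCat.{u}) : ((cocycleModel n).obj M).obj (op ⦋n⦌) ⟶ M :=
  AddCommGrpCat.ofHom (AddMonoidHom.mk' (fun a => modelValue a (𝟙 _)) fun _ _ => rfl)

lemma isZero_objX (h : m ≠ n) :
    Limits.IsZero (objX ((cocycleModel n).obj M) m : AddCommGrpCat.{u}) := by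
  refine @AddCommGrpCat.isZero_of_subsingleton _ (subsingleton_of_forall_eq 0 fun x => ?_)
  refine (AddCommGrpCat.mono_iff_injective (objX ((cocycleModel n).obj M) m).arrow).1
    inferInstance ?_
  rw [map_zero]
  exact normalizedCocyclesObj_ext n fun β => (higherFacesZero_arrow x).eq_zero_of_ne h β

/-- `fundamentalSimplex` as a homomorphism. -/
def fundamentalSimplexHom (M : AddCommGrpCat.{u}) :
    M ⟶ ((cocycleModel n).obj M).obj (op ⦋n⦌) :=
  AddCommGrpCat.ofHom (AddMonoidHom.mk' (fundamentalSimplex n M) fun x y =>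
    normalizedCocyclesObj_ext n fun β => by
      change (if β = 𝟙 _ then x + y else 0 : M) =
        (if β = 𝟙 _ then x else 0 : M) + (if β = 𝟙 _ then y else 0 : M)
      split_ifs <;> simp)

lemma factors_fundamentalSimplexHom (M : AddCommGrpCat.{u}) :
    (objX ((cocycleModel n).obj M) n).Factors (fundamentalSimplexHom M) := by
  cases n with
  | zero => exact Subobject.top_factors _
  | succ n =>
    refine (Subobject.finset_inf_factors _).2 fun i _ =>
      Limits.kernelSubobject_factors _ _ ?_
    refine AddCommGrpCat.hom_ext (AddMonoidHom.ext fun x => ?_)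
    refine normalizedCocyclesObj_ext _ fun γ => ?_
    refine if_neg fun h => ?_
    have : Mono (γ ≫ SimplexCategory.δ i.succ) := h ▸ inferInstance
    have : Mono γ := mono_of_mono γ (SimplexCategory.δ i.succ)
    have : n + 1 ≤ n := SimplexCategory.len_le_of_mono γ
    lia

variable (n) in
/-- The evaluation at the nondegenerate simplex, on the normalized Moore complex. -/
noncomputable def mooreEval (M : AddCommGrpCat.{u}) :
    ((cocycleModel n ⋙ normalizedMooreComplex _).obj M).X n ⟶ M :=
  (objX ((cocycleModel n).obj M) n).arrow ≫ evalId M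

lemma mooreEval_naturality {M M' : AddCommGrpCat.{u}} (f : M ⟶ M') :
    ((cocycleModel n ⋙ normalizedMooreComplex _).map f).f n ≫ mooreEval n M' =
      mooreEval n M ≫ f := by
  have h := congrArg (fun φ => φ.f n)
    ((inclusionOfMooreComplex AddCommGrpCat.{u}).naturality ((cocycleModel n).map f))
  simp only [HomologicalComplex.comp_f, inclusionOfMooreComplex_app, inclusionOfMooreComplexMap_f]
    at h
  exact congrArg (· ≫ evalId M') h

lemma isZero_moore (h : m ≠ n) :
    Limits.IsZero (((cocycleModel n ⋙ normalizedMooreComplex _).obj M).X m) :=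
  isZero_objX h

lemma d_comp_mooreEval (M : AddCommGrpCat.{u}) (i : ℕ) (hi : (ComplexShape.down ℕ).Rel i n) :
    ((cocycleModel n ⋙ normalizedMooreComplex _).obj M).d i n ≫ mooreEval n M = 0 :=
  (isZero_moore (by rintro rfl; simp at hi)).eq_of_src _ _

instance isIso_mooreEval (M : AddCommGrpCat.{u}) : IsIso (mooreEval n M) := by
  change IsIso ((objX ((cocycleModel n).obj M) n).arrow ≫ evalId M)
  rw [ConcreteCategory.isIso_iff_bijective]
  constructor
  · intro x y h
    refine (AddCommGrpCat.mono_iff_injective (objX ((cocycleModel n).obj M) n).arrow).1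
      inferInstance (normalizedCocyclesObj_ext n fun β => ?_)
    by_cases hβ : β = 𝟙 _
    · rw [hβ]
      exact h
    · exact (modelValue_eq_zero_of_ne_id _ β hβ).trans (modelValue_eq_zero_of_ne_id _ β hβ).symm
  · intro x
    refine ⟨Subobject.factorThru _ _ (factors_fundamentalSimplexHom M) x, ?_⟩
    have h := ConcreteCategory.congr_hom (Subobject.factorThru_arrow _ _
      (factors_fundamentalSimplexHom (n := n) M)) x
    refine (congrArg (evalId M) h).trans ?_
    exact if_pos rfl

/-- The normalized Moore complex of the model is concentrated in degree `n`. -/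
noncomputable def mooreToSingle : cocycleModel.{u} n ⋙ normalizedMooreComplex _ ⟶
    HomologicalComplex.single AddCommGrpCat.{u} (ComplexShape.down ℕ) n where
  app M := HomologicalComplex.mkHomToSingle (mooreEval n M) (d_comp_mooreEval M)
  naturality M M' f := by
    refine HomologicalComplex.to_single_hom_ext ?_
    rw [HomologicalComplex.comp_f, HomologicalComplex.comp_f, HomologicalComplex.mkHomToSingle_f,
      HomologicalComplex.mkHomToSingle_f, HomologicalComplex.single_map_f_self,
      ← Category.assoc, mooreEval_naturality]
    simp

lemma isIso_mooreToSingle_app (M : AddCommGrpCat.{u}) :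
    IsIso ((mooreToSingle (n := n)).app M) := by
  have : ∀ i, IsIso (((mooreToSingle (n := n)).app M).f i) := by
    intro i
    by_cases hi : i = n
    · subst hi
      dsimp only [mooreToSingle]
      rw [HomologicalComplex.mkHomToSingle_f]
      infer_instance
    · exact (isZero_moore hi).isIso (HomologicalComplex.isZero_single_obj_X _ _ _ _ hi) _
  exact HomologicalComplex.Hom.isIso_of_components _

variable (n) in
/-- Under the Dold-Kan correspondence, the groups of normalized cocycles correspond to complexes
concentrated in one degree. -/
noncomputable def cocycleModelIso : cocycleModel.{u} n ≅
    HomologicalComplex.single AddCommGrpCat.{u} (ComplexShape.down ℕ) n ⋙ Abelian.DoldKan.Γ :=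
  have : IsIso (mooreToSingle.{u} (n := n)) :=
    have := isIso_mooreToSingle_app.{u} (n := n)
    NatIso.isIso_of_isIso_app _
  Functor.isoWhiskerLeft (cocycleModel n)
      (Abelian.DoldKan.equivalence (A := AddCommGrpCat.{u})).unitIso ≪≫
    Functor.isoWhiskerRight (asIso (mooreToSingle.{u} (n := n))) Abelian.DoldKan.Γ

end EilenbergMacLane

/-! ### Function complexes into the model -/

section FunctionComplex

variable {n : ℕ} {A : CosimplicialObject AddCommGrpCat.{u}} {m : SimplexCategory}

variable (n A) in
/-- The cosimplicial simplicial abelian group which is the model of `K(A, n)`. -/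
abbrev modelObj : CosimplicialObject (SimplicialObject AddCommGrpCat.{u}) :=
  ((Functor.whiskeringRight _ _ _).obj (cocycleModel n)).obj A

variable (n A m) in
/-- The `m`-simplices of the function complex from `Δ` to the model of `K(A, n)`. -/
abbrev ModelMap : Type u :=
  (prodSimplex SSet.stdSimplex.{u}).obj m ⟶ toCosimplicialSpace (modelObj n A)

/-- The simplex of `Δ[c] × Δ[m]` with given components. -/
def pairSimplex {c l : SimplexCategory} (x : l ⟶ c) (β : l ⟶ m) :
    (((prodSimplex SSet.stdSimplex.{u}).obj m).obj c).obj (op l) :=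
  (SSet.stdSimplex.objEquiv.symm x, SSet.stdSimplex.objEquiv.symm β)

/-- The values of a map into the model. -/
def ModelMap.value (f : ModelMap n A m) {c l : SimplexCategory} (x : l ⟶ c) (β : l ⟶ m) :
    normalizedCocycles n ((Functor.const SimplexCategory).obj (A.obj c)) l :=
  (component f c).app (op l) (pairSimplex x β)

lemma ModelMap.ext_value {f g : ModelMap n A m}
    (h : ∀ {c l : SimplexCategory} (x : l ⟶ c) (β : l ⟶ m) (θ : ⦋n⦌ ⟶ l),
      (f.value x β).1 θ = (g.value x β).1 θ) : f = g := by
  refine cosimplicialMap_ext fun c => map_ext fun ⟨l⟩ ⟨x, β⟩ => ?_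
  exact Subtype.ext (funext fun θ => h (SSet.stdSimplex.objEquiv x) (SSet.stdSimplex.objEquiv β) θ)

/-- The cochain on the simplex `m` associated with a map into the model: the value at the
diagonal simplices. -/
def ModelMap.cochain (f : ModelMap n A m) (β : ⦋n⦌ ⟶ m) : A.obj ⦋n⦌ :=
  (f.value (𝟙 _) β).1 (𝟙 _)

/-- A map into the model is determined by its cochain, by naturality in both variables. -/
lemma ModelMap.value_apply (f : ModelMap n A m) {c l : SimplexCategory} (x : l ⟶ c) (β : l ⟶ m)
    (θ : ⦋n⦌ ⟶ l) : (f.value x β).1 θ = A.map (θ ≫ x) (f.cochain (θ ≫ β)) := by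
  have h₁ : (f.value (θ ≫ x) (θ ≫ β)).1 (𝟙 _) = (f.value x β).1 (𝟙 _ ≫ θ) :=
    congrArg (fun (a : normalizedCocycles n ((Functor.const SimplexCategory).obj (A.obj c)) _) =>
      a.1 (𝟙 _)) (ConcreteCategory.congr_hom ((component f c).naturality θ.op) (pairSimplex x β))
  have h₂ : (f.value (𝟙 _ ≫ θ ≫ x) (θ ≫ β)).1 (𝟙 _) =
      A.map (θ ≫ x) ((f.value (𝟙 _) (θ ≫ β)).1 (𝟙 _)) :=
    congrArg (fun (a : normalizedCocycles n ((Functor.const SimplexCategory).obj (A.obj c)) _) =>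
      a.1 (𝟙 _)) (ConcreteCategory.congr_hom (NatTrans.congr_app
        (component_naturality f (θ ≫ x)) (op ⦋n⦌)) (pairSimplex (𝟙 _) (θ ≫ β)))
  rw [Category.id_comp] at h₁ h₂
  exact h₁.symm.trans h₂

lemma ModelMap.cochain_mem (f : ModelMap n A m) : f.cochain ∈ normalizedCocycles n A m := by
  refine ⟨fun p hp σ β => ?_, fun β => ?_⟩
  · have h := (f.value (𝟙 _) β).2.1 p hp σ (𝟙 _)
    have h' := f.value_apply (𝟙 _) β (σ ≫ 𝟙 _)
    simp only [Category.comp_id] at h'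
    refine h'.symm.trans (Eq.trans ?_ h)
    rw [Category.comp_id]
    rfl
  · refine Eq.trans (Finset.sum_congr rfl fun i _ => ?_) ((f.value (𝟙 _) β).2.2 (𝟙 _))
    refine congrArg ((-1 : ℤ) ^ (i : ℕ) • ·) ?_
    have h' := f.value_apply (𝟙 _) β (SimplexCategory.δ i ≫ 𝟙 _)
    simp only [Category.comp_id] at h'
    refine h'.symm.trans ?_
    rw [Category.comp_id]
    rfl

/-- The values of the map into the model associated with a normalized cocycle. -/
def valueOfCocycle (a : normalizedCocycles n A m) {c l : SimplexCategory} (x : l ⟶ c)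
    (β : l ⟶ m) : normalizedCocycles n ((Functor.const SimplexCategory).obj (A.obj c)) l :=
  ⟨fun θ => A.map (θ ≫ x) (a.1 (θ ≫ β)), fun p hp σ τ => by
    change A.map ((σ ≫ τ) ≫ x) (a.1 ((σ ≫ τ) ≫ β)) = 0
    rw [Category.assoc, Category.assoc, A.map_comp]
    exact (congrArg (A.map (τ ≫ x)) (a.2.1 p hp σ (τ ≫ β))).trans (map_zero (A.map (τ ≫ x)).hom),
    fun τ => by
    have h := (congrArg (A.map (τ ≫ x)) (a.2.2 (τ ≫ β))).trans (map_zero (A.map (τ ≫ x)).hom)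
    rw [map_sum] at h
    refine Eq.trans (Finset.sum_congr rfl fun i _ => ?_) h
    rw [map_zsmul]
    refine congrArg ((-1 : ℤ) ^ (i : ℕ) • ·) ?_
    change A.map ((SimplexCategory.δ i ≫ τ) ≫ x) (a.1 ((SimplexCategory.δ i ≫ τ) ≫ β)) = _
    rw [Category.assoc, Category.assoc, A.map_comp]
    rfl⟩

/-- The map into the model associated with a normalized cocycle. -/
def mapOfCocycle (a : normalizedCocycles n A m) : ModelMap n A m where
  app c :=
    { app := fun l => TypeCat.ofHom fun s =>
        (valueOfCocycle a (SSet.stdSimplex.objEquiv s.1) (SSet.stdSimplex.objEquiv s.2) :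
          normalizedCocycles n ((Functor.const SimplexCategory).obj (A.obj c)) l.unop)
      naturality := fun l l' θ => by
        ext ⟨x, β⟩
        refine Subtype.ext (funext fun τ => ?_)
        change A.map (τ ≫ θ.unop ≫ SSet.stdSimplex.objEquiv x)
          (a.1 (τ ≫ θ.unop ≫ SSet.stdSimplex.objEquiv β)) =
          A.map ((τ ≫ θ.unop) ≫ SSet.stdSimplex.objEquiv x)
          (a.1 ((τ ≫ θ.unop) ≫ SSet.stdSimplex.objEquiv β))
        rw [Category.assoc, Category.assoc] }
  naturality c c' φ := by
    ext l ⟨x, β⟩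
    refine Subtype.ext (funext fun τ => ?_)
    change A.map (τ ≫ SSet.stdSimplex.objEquiv x ≫ φ) (a.1 (τ ≫ SSet.stdSimplex.objEquiv β)) =
      A.map φ (A.map (τ ≫ SSet.stdSimplex.objEquiv x) (a.1 (τ ≫ SSet.stdSimplex.objEquiv β)))
    rw [← Category.assoc, A.map_comp]
    rfl

lemma cochain_mapOfCocycle (a : normalizedCocycles n A m) : (mapOfCocycle a).cochain = a.1 := by
  funext β
  change A.map (𝟙 _ ≫ 𝟙 _) (a.1 (𝟙 _ ≫ β)) = _
  rw [Category.id_comp, Category.id_comp, A.map_id]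
  rfl

variable (n A m) in
/-- Maps into the model correspond to normalized cocycles on the simplex. -/
def modelMapEquiv : ModelMap n A m ≃+ normalizedCocycles n A m where
  toFun f := ⟨f.cochain, f.cochain_mem⟩
  invFun := mapOfCocycle
  left_inv f := ModelMap.ext_value fun x β θ => by
    rw [ModelMap.value_apply, cochain_mapOfCocycle, ModelMap.value_apply]
  right_inv a := Subtype.ext (cochain_mapOfCocycle a)
  map_add' _ _ := rfl

variable (n) in
/-- The function complex from `Δ` to the model of `K(A, n)` is the simplicial group of normalized
cocycles. -/
def functionComplexIso :
    (Functor.whiskeringRight _ _ _).obj (cocycleModel.{u} n) ⋙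
      homComplexGroupFunctor SSet.stdSimplex ≅ normalizedCocyclesFunctor n :=
  NatIso.ofComponents
    (fun A => NatIso.ofComponents (fun m => (modelMapEquiv n A m.unop).toAddCommGrpIso)
      fun _ => rfl)
    fun _ => rfl

/-- The function complex from `Δ` to `K(A, n)` is the simplicial group of normalized cocycles. -/
noncomputable def eilenbergMacLaneFunctionComplexIso (n : ℕ) :
    eilenbergMacLane.{u} n ⋙ homComplexGroupFunctor SSet.stdSimplex ≅
      normalizedCocyclesFunctor n :=
  Functor.isoWhiskerRight ((Functor.whiskeringRight _ _ _).mapIso (cocycleModelIso n).symm) _ ≪≫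
    functionComplexIso n

/-- The homotopy groups of the function complex, in terms of normalized cocycles. -/
noncomputable def piHomIso (k n : ℕ) :
    piHom.{u} k n ≅ normalizedCocyclesFunctor n ⋙ homotopyGroupFunctor k :=
  Functor.isoWhiskerRight (eilenbergMacLaneFunctionComplexIso n) (homotopyGroupFunctor k)

end FunctionComplex
end AbelianCosimplicial

theorem corollary20 (n k : ℕ) :
    (k ≤ n →
      Nonempty (AbelianCosimplicial.piHom.{u} k n ≅ AbelianCosimplicial.cohomology.{u} (n - k))) ∧
    (n < k → ∀ A : CosimplicialObject AddCommGrpCat.{u},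
      Subsingleton ((AbelianCosimplicial.piHom.{u} k n).obj A)) := by
  open AbelianCosimplicial in
  refine ⟨fun h => ?_, fun h A => ?_⟩
  · obtain ⟨p, rfl⟩ := Nat.exists_eq_add_of_le' h
    rw [Nat.add_sub_cancel]
    exact ⟨piHomIso k (p + k) ≪≫ homotopyIso (p + k) k ≪≫ boundaryCohomology p k⟩
  · have := subsingleton_homotopy (A := A) h
    exact @Equiv.subsingleton _ _ ((piHomIso k n).app A).addCommGroupIsoToAddEquiv.toEquiv this
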